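/- Fix disjoint countably infinite sets of concept names $A$, role names $r$ and individual names $a$, and let $u$ be the universal role. For a finite set $I$ of modalities, terms $\tau$ and concepts $C$ of $\mathcal{ML}_{\mathcal{ALCO}_u^{\iota}}$ are given by $$\tau ::= a \mid \iota C,\qquad C ::= A \mid \{\tau\} \mid \neg C \mid (C\sqcap C)\mid \exists r.C\mid \exists u.C\mid \Diamond_i C\quad (i\in I).$$ An ontology is a finite set of concept inclusions $C\sqsubseteq D$. A frame consists of a non-empty set $W$ of worlds and a relation $R_i\subseteq W\times W$ for each $i\in I$. An expanding-domain model on it assigns to each world $w$ a non-empty domain $\Delta^w$, with $\Delta^w\subseteq\Delta^v$ whenever $wR_iv$ for some $i$, and interprets at $w$ concept names as subsets of $\Delta^w$, role names as binary relations on $\Delta^w$, and individual names as elements of $\Delta^w$; individual names may designate different elements at different worlds and may fail to designate. The model is total if every individual name designates at every world. At $w$, the term $\iota C$ designates $d$ if $C^{\mathcal I_w}=\{d\}$ and designates nothing if $C^{\mathcal I_w}$ is not a singleton; $\{\tau\}^{\mathcal I_w}$ is $\{d\}$ if $\tau$ designates $d$ at $w$, and is empty if $\tau$ does not designate. The constructors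 $\neg$, $\sqcap$, $\exists r$ are interpreted as usual in $\Delta^w$, $u$ is interpreted as $\Delta^w\times\Delta^w$, and $(\Diamond_i C)^{\mathcal I_w}=\{d\in\Delta^w\mid d\in C^{\mathcal I_v}\text{ for some }v\text{ with }wR_iv\}$. Concept satisfiability under ontologies over a class of frames (with expanding domains) is the problem whether, given a concept $C$ and an ontology $\mathcal O$, there is an expanding-domain model on a frame of the class such that $E^{\mathcal I_w}\subseteq D^{\mathcal I_w}$ for all $E\sqsubseteq D$ in $\mathcal O$ and all worlds $w$, and $C^{\mathcal I_w}\neq\emptyset$ for some world $w$. **Theorem.** Concept satisfiability under ontologies with expanding domains is decidable for each of the following logics, both over all models and over total models: 1. $\mathbf{K}\boldsymbol{f}^{\ast n}_{\mathcal{ALCO}_u^{\iota}}$, for every $n$: the class of frames $(W,R_1,\dots,R_n,R)$ (with a modal operator for each of the $n+1$ relations) such that $W$ is finite, $R$ is the transitive closure of $R_1\cup\dots\cup R_n$, and $R$ is irreflexive; 2. $\mathbf{GL}_{\mathcal{ALCO}_u^{\iota}}$: the class of frames $(W,R)$ such that $R$ is transitive and there is no infinite chain $w_0Rw_1Rw_2R\cdots$;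 3. $\mathbf{Grz}_{\mathcal{ALCO}_u^{\iota}}$: the class of frames $(W,R)$ such that $R$ is a partial order and there is no infinite chain $w_0Rw_1Rw_2R\cdots$ with $w_k\neq w_{k+1}$ for all $k$. -/

import Mathlib

namespace ModalDL

/-- Concepts of the modal description logic with nominals, universal role and definite
descriptions, with `m` modal operators. Concept, role and individual names are the natural
numbers, in three separate sorts. A term is an individual name `a` or a definite description
`ιC`, and terms occur in concepts exactly as nominals `{a}` (`nom a`) and `{ιC}` (`desc C`). -/
inductive Concept (m : ℕ) : Type
  | name (A : ℕ) : Concept m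
  | nom (a : ℕ) : Concept m
  | desc (C : Concept m) : Concept m
  | neg (C : Concept m) : Concept m
  | and (C D : Concept m) : Concept m
  | ex (r : ℕ) (C : Concept m) : Concept m
  | exU (C : Concept m) : Concept m
  | dia (i : Fin m) (C : Concept m) : Concept m

namespace Concept

variable {m : ℕ}

/-- The Gödel number of a concept; the last octal digit is the outermost constructor. -/
def encode : Concept m → ℕ
  | name A => 8 * A
  | nom a => 8 * a + 1
  | desc C => 8 * encode C + 2
  | neg C => 8 * encode C + 3
  | and C D => 8 * Nat.pair (encode C) (encode D) + 4
  | ex r C => 8 * Nat.pair r (encode C) + 5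
  | exU C => 8 * encode C + 6
  | dia i C => 8 * (m * encode C + i) + 7

/-- The concept with a given Gödel number. -/
def ofNat [NeZero m] (k : ℕ) : Concept m :=
  if h0 : k % 8 = 0 then name (k / 8)
  else
    have hlt : k / 8 < k := by omega
    if k % 8 = 1 then nom (k / 8)
    else if k % 8 = 2 then desc (ofNat (k / 8))
    else if k % 8 = 3 then neg (ofNat (k / 8))
    else if k % 8 = 4 then
      have h1 : (k / 8).unpair.1 < k := (Nat.unpair_left_le _).trans_lt hlt
      have h2 : (k / 8).unpair.2 < k := (Nat.unpair_right_le _).trans_lt hlt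
      and (ofNat (k / 8).unpair.1) (ofNat (k / 8).unpair.2)
    else if k % 8 = 5 then
      have h2 : (k / 8).unpair.2 < k := (Nat.unpair_right_le _).trans_lt hlt
      ex (k / 8).unpair.1 (ofNat (k / 8).unpair.2)
    else if k % 8 = 6 then exU (ofNat (k / 8))
    else
      have h3 : k / 8 / m < k := (Nat.div_le_self _ _).trans_lt hlt
      dia (Fin.ofNat m (k / 8)) (ofNat (k / 8 / m))
termination_by k

theorem ofNat_encode [NeZero m] (C : Concept m) : ofNat (encode C) = C := by
  have e : ∀ x t : ℕ, t < 8 → (8 * x + t) % 8 = t ∧ (8 * x + t) / 8 = x := by omega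
  induction C with
  | name A => rw [encode, ofNat]; simp
  | nom a => rw [encode, ofNat]; simp [e a 1 (by norm_num)]
  | desc C ih => rw [encode, ofNat]; simp [e _ 2 (by norm_num), ih]
  | neg C ih => rw [encode, ofNat]; simp [e _ 3 (by norm_num), ih]
  | and C D ihC ihD => rw [encode, ofNat]; simp [e _ 4 (by norm_num), ihC, ihD]
  | ex r C ih => rw [encode, ofNat]; simp [e _ 5 (by norm_num), ih]
  | exU C ih => rw [encode, ofNat]; simp [e _ 6 (by norm_num), ih]
  | dia i C ih =>
    have hm : 0 < m := NeZero.pos m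
    have h1 : (m * encode C + i) / m = encode C := by
      rw [Nat.mul_add_div hm, Nat.div_eq_of_lt i.2, Nat.add_zero]
    have h2 : Fin.ofNat m (m * encode C + i) = i := by
      apply Fin.ext
      simp [Fin.ofNat, Nat.mod_eq_of_lt i.2]
    rw [encode, ofNat]
    simp [e _ 7 (by norm_num), h1, ih, -Fin.ofNat_eq_cast, h2]

theorem encode_ofNat [NeZero m] (k : ℕ) : encode (ofNat k : Concept m) = k := by
  induction k using Nat.strong_induction_on with
  | _ k ih =>
    rw [ofNat]
    split_ifs with h0 h1 h2 h3 h4 h5 h6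
    · simp only [encode]; omega
    · simp only [encode]; omega
    · simp only [encode]; rw [ih _ (by omega)]; omega
    · simp only [encode]; rw [ih _ (by omega)]; omega
    · have hlt : k / 8 < k := by omega
      simp only [encode]
      rw [ih _ ((Nat.unpair_left_le _).trans_lt hlt),
        ih _ ((Nat.unpair_right_le _).trans_lt hlt), Nat.pair_unpair]
      omega
    · have hlt : k / 8 < k := by omega
      simp only [encode]
      rw [ih _ ((Nat.unpair_right_le _).trans_lt hlt), Nat.pair_unpair]
      omega
    · simp only [encode]; rw [ih _ (by omega)]; omega
    · have hlt : k / 8 < k := by omega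
      simp only [encode]
      rw [ih _ ((Nat.div_le_self _ _).trans_lt hlt)]
      have : m * (k / 8 / m) + k / 8 % m = k / 8 := Nat.div_add_mod _ _
      simp only [Fin.ofNat]
      omega

/-- The bijective Gödel numbering `encode`, which fixes what computability on concepts means. -/
instance instDenumerable [NeZero m] : Denumerable (Concept m) :=
  Denumerable.mk' ⟨encode, ofNat, ofNat_encode, encode_ofNat⟩

end Concept

/-- A finite set of concept inclusions `C ⊑ D`, listed as pairs `(C, D)`. -/
abbrev Ontology (m : ℕ) : Type := List (Concept m × Concept m)

/-- A frame with `m` accessibility relations. -/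
structure Frame (m : ℕ) where
  World : Type
  nonempty : Nonempty World
  R : Fin m → World → World → Prop

/-- A partial interpretation with expanding domains based on the frame `F`. Individual names are
interpreted at each world separately (non-rigidly), and may fail to designate. -/
structure PartialInterpretation {m : ℕ} (F : Frame m) where
  Carrier : Type
  dom : F.World → Set Carrier
  dom_nonempty : ∀ w, (dom w).Nonempty
  expanding : ∀ i w v, F.R i w v → dom w ⊆ dom v
  conceptName : F.World → ℕ → Set Carrier
  conceptName_subset : ∀ w A, conceptName w A ⊆ dom w
  roleName : F.World → ℕ → Carrier → Carrier → Prop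
  roleName_dom : ∀ w r d e, roleName w r d e → d ∈ dom w ∧ e ∈ dom w
  individual : F.World → ℕ → Option Carrier
  individual_mem : ∀ w a d, individual w a = some d → d ∈ dom w

namespace PartialInterpretation

variable {m : ℕ} {F : Frame m} (M : PartialInterpretation F)

/-- The interpretation is total: every individual name designates at every world. -/
def IsTotal : Prop := ∀ w a, (M.individual w a).isSome

/-- The extension of a concept at a world. The description `ιC` designates `d` at `w` exactly when
`d` is the only element of the extension of `C` at `w`. -/
def ext : Concept m → F.World → Set M.Carrier
  | .name A, w => M.conceptName w A
  | .nom a, w => {d | M.individual w a = some d}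
  | .desc C, w => {d | ext C w = {d}}
  | .neg C, w => M.dom w \ ext C w
  | .and C D, w => ext C w ∩ ext D w
  | .ex r C, w => {d | d ∈ M.dom w ∧ ∃ e, M.roleName w r d e ∧ e ∈ ext C w}
  | .exU C, w => {d | d ∈ M.dom w ∧ ∃ e, e ∈ M.dom w ∧ e ∈ ext C w}
  | .dia i C, w => {d | d ∈ M.dom w ∧ ∃ v, F.R i w v ∧ d ∈ ext C v}

/-- All concept inclusions of the ontology hold at all worlds. -/
def Models (O : Ontology m) : Prop := ∀ p ∈ O, ∀ w, M.ext p.1 w ⊆ M.ext p.2 w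

end PartialInterpretation

/-- `C` is satisfiable under the ontology `O` in a partial interpretation with expanding domains
based on a frame of the class `𝒞`. -/
def Satisfiable {m : ℕ} (𝒞 : Set (Frame m)) (C : Concept m) (O : Ontology m) : Prop :=
  ∃ F ∈ 𝒞, ∃ M : PartialInterpretation F, M.Models O ∧ ∃ w, (M.ext C w).Nonempty

/-- `C` is satisfiable under the ontology `O` in a total interpretation with expanding domains
based on a frame of the class `𝒞`. -/
def TotallySatisfiable {m : ℕ} (𝒞 : Set (Frame m)) (C : Concept m) (O : Ontology m) : Prop :=
  ∃ F ∈ 𝒞, ∃ M : PartialInterpretation F,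
    M.IsTotal ∧ M.Models O ∧ ∃ w, (M.ext C w).Nonempty

/-- Concept satisfiability under ontologies over the frame class `𝒞` with expanding domains is
decidable, both over partial and over total interpretations. -/
def DecidableSatisfiability {m : ℕ} [NeZero m] (𝒞 : Set (Frame m)) : Prop :=
  ComputablePred (fun p : Concept m × Ontology m => Satisfiable 𝒞 p.1 p.2) ∧
  ComputablePred (fun p : Concept m × Ontology m => TotallySatisfiable 𝒞 p.1 p.2)

/-- Finite frames `(W, R₁, …, Rₙ, R)`, where `R` is the transitive closure of `R₁ ∪ ⋯ ∪ Rₙ` and is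
irreflexive, so that there are no cycles. The last relation is `R`. -/
def KfStarFrames (n : ℕ) : Set (Frame (n + 1)) :=
  {F | Finite F.World ∧
    (∀ w v, F.R (Fin.last n) w v ↔
      Relation.TransGen (fun x y => ∃ i : Fin n, F.R i.castSucc x y) w v) ∧
    ∀ w, ¬ F.R (Fin.last n) w w}

/-- Transitive frames without infinite ascending chains `w₀ R w₁ R w₂ R ⋯`. -/
def GLFrames : Set (Frame 1) :=
  {F | (∀ u v w, F.R 0 u v → F.R 0 v w → F.R 0 u w) ∧
    ¬ ∃ f : ℕ → F.World, ∀ k, F.R 0 (f k) (f (k + 1))}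

/-- Partial orders without infinite strictly ascending chains. -/
def GrzFrames : Set (Frame 1) :=
  {F | (∀ w, F.R 0 w w) ∧
    (∀ u v w, F.R 0 u v → F.R 0 v w → F.R 0 u w) ∧
    (∀ u v, F.R 0 u v → F.R 0 v u → u = v) ∧
    ¬ ∃ f : ℕ → F.World, ∀ k, F.R 0 (f k) (f (k + 1)) ∧ f k ≠ f (k + 1)}

end ModalDL

-- Satisfiability and unsatisfiability both have finite certificates that a primitive recursive
-- predicate can check, so both are recursively enumerable and Post's theorem gives decidability.
-- Fix a bound `K` above all Gödel numbers of the input. The type of an element is the set of codes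
-- below `K` of the concepts to which it belongs, and a state is a finite sequence of types, the
-- abstraction of one world.
--
-- A positive certificate is a finite list of locally consistent states in which every diamond is
-- witnessed by a later state; it can be read as a finite model (`SatCert.satisfiable`). No bound on
-- the size of these states is used.
--
-- The negative certificates rest on two facts. Local conditions see the multiplicity of a type only
-- as zero, one or at least two (`LocalOK.of_embeds`). Moreover, domains expand, so elements
-- retained at a world persist at its successors. Hence surplus copies of a type can be dropped, and
-- the states that embed into no world of a model are upward closed for `Below`. By Dickson's lemma
-- a finite list of generators suffices (`exists_finite_basis`). Such a list refutes satisfiability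
-- if every consistent generator has a diamond all of whose witnesses are excluded again: an
-- excluded state in a model would lead to another one at a successor, against converse
-- well-foundedness (`UnsatCert.not_satisfiable`). If there is no positive certificate, generators
-- of the unrealizable states form such a list (`exists_unsatCert`).
--
-- The frame classes enter only through `Describes`: their diamonds obey a one-step unfolding
-- equation along conversely well-founded successor relations, and finite acyclic relations generate
-- frames of the class.

-- Closure properties of primitive recursive predicates

attribute [fun_prop] Primrec
attribute [fun_prop] Primrec.id Primrec.const Primrec.comp Primrec.pair

section PrimrecToolkit

variable {α β γ : Type*} [Primcodable α] [Primcodable β] [Primcodable γ]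

@[fun_prop]
theorem Primrec.fst_comp {f : α → β × γ} (hf : Primrec f) : Primrec fun a => (f a).1 :=
  Primrec.fst.comp hf

@[fun_prop]
theorem Primrec.snd_comp {f : α → β × γ} (hf : Primrec f) : Primrec fun a => (f a).2 :=
  Primrec.snd.comp hf

@[fun_prop]
theorem Primrec.add_comp {f g : α → ℕ} (hf : Primrec f) (hg : Primrec g) :
    Primrec fun a => f a + g a := Primrec.nat_add.comp hf hg

@[fun_prop]
theorem Primrec.mul_comp {f g : α → ℕ} (hf : Primrec f) (hg : Primrec g) :
    Primrec fun a => f a * g a := Primrec.nat_mul.comp hf hg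

@[fun_prop]
theorem Primrec.div_comp {f g : α → ℕ} (hf : Primrec f) (hg : Primrec g) :
    Primrec fun a => f a / g a := Primrec.nat_div.comp hf hg

@[fun_prop]
theorem Primrec.mod_comp {f g : α → ℕ} (hf : Primrec f) (hg : Primrec g) :
    Primrec fun a => f a % g a := Primrec.nat_mod.comp hf hg

@[fun_prop]
theorem Primrec.pow_comp {f g : α → ℕ} (hf : Primrec f) (hg : Primrec g) :
    Primrec fun a => f a ^ g a :=
  (Primrec₂.unpaired'.1 Nat.Primrec.pow : Primrec₂ fun x y : ℕ => x ^ y).comp hf hg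

@[fun_prop]
theorem Primrec.natPair_comp {f g : α → ℕ} (hf : Primrec f) (hg : Primrec g) :
    Primrec fun a => Nat.pair (f a) (g a) := Primrec₂.natPair.comp hf hg

@[fun_prop]
theorem Primrec.list_length_comp {f : α → List β} (hf : Primrec f) :
    Primrec fun a => (f a).length := Primrec.list_length.comp hf

@[fun_prop]
theorem Primrec.list_getD_comp {f : α → List β} {g : α → ℕ} {d : β} (hf : Primrec f)
    (hg : Primrec g) : Primrec fun a => (f a).getD (g a) d := (Primrec.list_getD d).comp hf hg

theorem PrimrecPred.nat_lt_comp {f g : α → ℕ} (hf : Primrec f) (hg : Primrec g) :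
    PrimrecPred fun a => f a < g a := Primrec.nat_lt.comp hf hg

theorem PrimrecPred.nat_le_comp {f g : α → ℕ} (hf : Primrec f) (hg : Primrec g) :
    PrimrecPred fun a => f a ≤ g a := Primrec.nat_le.comp hf hg

theorem PrimrecPred.nat_eq_comp {f g : α → ℕ} (hf : Primrec f) (hg : Primrec g) :
    PrimrecPred fun a => f a = g a := Primrec.eq.comp hf hg

/-- The truth value of `p` does not depend on the input, so it may be fixed classically. This covers
the fields `refl` and `total` of `Spec`. -/
theorem PrimrecPred.const_prop (p : Prop) : PrimrecPred fun _ : α => p := by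
  classical
  exact ⟨fun _ => inferInstance, Primrec.const (decide p)⟩

theorem PrimrecPred.imp {p q : α → Prop} (hp : PrimrecPred p) (hq : PrimrecPred q) :
    PrimrecPred fun a => p a → q a :=
  (hp.not.or hq).of_eq fun _ => imp_iff_not_or.symm

theorem PrimrecPred.iff {p q : α → Prop} (hp : PrimrecPred p) (hq : PrimrecPred q) :
    PrimrecPred fun a => p a ↔ q a :=
  ((hp.imp hq).and (hq.imp hp)).of_eq fun _ => iff_def.symm

theorem PrimrecPred.ball_mem {l : α → List β} {p : α → β → Prop} (hl : Primrec l)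
    (hp : PrimrecPred fun x : α × β => p x.1 x.2) : PrimrecPred fun a => ∀ b ∈ l a, p a b :=
  (PrimrecRel.forall_mem_list
    (show PrimrecRel fun (b : β) (a : α) => p a b from hp.primrecRel.swap)).comp hl Primrec.id

theorem PrimrecPred.bex_mem {l : α → List β} {p : α → β → Prop} (hl : Primrec l)
    (hp : PrimrecPred fun x : α × β => p x.1 x.2) : PrimrecPred fun a => ∃ b ∈ l a, p a b :=
  (PrimrecRel.exists_mem_list
    (show PrimrecRel fun (b : β) (a : α) => p a b from hp.primrecRel.swap)).comp hl Primrec.id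

theorem PrimrecPred.ball_lt {f : α → ℕ} {p : α → ℕ → Prop} (hf : Primrec f)
    (hp : PrimrecPred fun x : α × ℕ => p x.1 x.2) : PrimrecPred fun a => ∀ k < f a, p a k :=
  (PrimrecPred.ball_mem (Primrec.list_range.comp hf) hp).of_eq fun a => by simp

theorem PrimrecPred.bex_lt {f : α → ℕ} {p : α → ℕ → Prop} (hf : Primrec f)
    (hp : PrimrecPred fun x : α × ℕ => p x.1 x.2) : PrimrecPred fun a => ∃ k < f a, p a k :=
  (PrimrecPred.bex_mem (Primrec.list_range.comp hf) hp).of_eq fun a => by simp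

theorem Primrec.count_lt {f : α → ℕ} {p : α → ℕ → Prop} [∀ a, DecidablePred (p a)]
    (hf : Primrec f) (hp : PrimrecPred fun x : α × ℕ => p x.1 x.2) :
    Primrec fun a => ((List.range (f a)).filter fun k => p a k).length := by
  have h : PrimrecRel fun (k : ℕ) (a : α) => p a k := hp.primrecRel.swap
  exact Primrec.list_length.comp
    ((PrimrecRel.listFilter h).comp (Primrec.list_range.comp hf) Primrec.id)

/-- Projections of primitive recursive predicates are recursively enumerable. -/
theorem REPred.exists_of_primrecPred {p : α → β → Prop} (hp : PrimrecPred fun x : α × β => p x.1 x.2) :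
    REPred fun a => ∃ b, p a b := by
  classical
  let g : α → ℕ → Option Unit := fun a k =>
    (Encodable.decode (α := β) k).bind fun b => if p a b then some () else none
  have hg : Primrec₂ g := by
    refine Primrec.option_bind (Primrec.decode.comp Primrec.snd) ?_
    refine Primrec.ite ?_ (Primrec.const _) (Primrec.const _)
    exact hp.comp ((Primrec.fst.comp Primrec.fst).pair Primrec.snd)
  refine (Partrec.dom_re (Partrec.rfindOpt hg.to_comp)).of_eq fun a => ?_
  rw [Nat.rfindOpt_dom]
  constructor
  · rintro ⟨k, u, hu⟩
    simp only [g, Option.mem_def, Option.bind_eq_some_iff] at hu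
    obtain ⟨b, -, hb⟩ := hu
    split_ifs at hb with h
    exact ⟨b, h⟩
  · rintro ⟨b, hb⟩
    exact ⟨Encodable.encode b, (), by simp [g, hb]⟩

end PrimrecToolkit

/-! ### Types, states and certificates -/

namespace ModalDL

/-- The shape of a class of frames with `mods` modal operators: the modal operators from `base` on
refer to all nonempty paths along `steps` successor relations (and to the empty path if `refl`
holds), the other ones to the successor relation of the same index. Under `total`, every individual
name designates. -/
structure Spec where
  mods : ℕ
  base : ℕ
  steps : ℕ
  refl : Prop
  total : Prop

/-- `c` is an element of the finite set with code `t`. -/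
def Bit (t c : ℕ) : Prop := t / 2 ^ c % 2 = 1

theorem bit_iff_testBit {t c : ℕ} : Bit t c ↔ t.testBit c = true := by
  simp [Bit, Nat.testBit_eq_decide_div_mod_eq]

/-- A finite state `(l, x)` consists of `l` elements; `row K s p` is the type of its `p`-th element,
a finite set of Gödel numbers below `K`. -/
def row (K : ℕ) (s : ℕ × ℕ) (p : ℕ) : ℕ := s.2 / (2 ^ K) ^ p % 2 ^ K

def andCode (d e : ℕ) : ℕ := 8 * Nat.pair d e + 4

def exCode (r e : ℕ) : ℕ := 8 * Nat.pair r e + 5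

def diaCode (m i e : ℕ) : ℕ := 8 * (m * e + i) + 7

/-- The elements of `D`, with types given by `ty`, satisfy all conditions on a single world that
concern concepts with Gödel number less than `K` and the ontology `O`. -/
structure LocalOK (σ : Spec) (K : ℕ) (O : List (ℕ × ℕ)) {α : Type*} (D : Set α) (ty : α → ℕ) :
    Prop where
  nonempty : D.Nonempty
  onto : ∀ q ∈ O, ∀ p ∈ D, Bit (ty p) q.1 → Bit (ty p) q.2
  nom : ∀ a < K, 8 * a + 1 < K → ∀ p ∈ D, ∀ q ∈ D,
    Bit (ty p) (8 * a + 1) → Bit (ty q) (8 * a + 1) → p = q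
  nom_total : σ.total → ∀ a < K, 8 * a + 1 < K → ∃ p ∈ D, Bit (ty p) (8 * a + 1)
  desc : ∀ e < K, 8 * e + 2 < K → ∀ p ∈ D,
    (Bit (ty p) (8 * e + 2) ↔ Bit (ty p) e ∧ ∀ q ∈ D, Bit (ty q) e → q = p)
  neg : ∀ e < K, 8 * e + 3 < K → ∀ p ∈ D, (Bit (ty p) (8 * e + 3) ↔ ¬ Bit (ty p) e)
  and : ∀ d < K, ∀ e < K, andCode d e < K → ∀ p ∈ D,
    (Bit (ty p) (andCode d e) ↔ Bit (ty p) d ∧ Bit (ty p) e)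
  ex : ∀ r < K, ∀ e < K, exCode r e < K → ∀ p ∈ D, Bit (ty p) (exCode r e) →
    ∃ q ∈ D, Bit (ty q) e ∧
      ∀ d < K, exCode r d < K → Bit (ty q) d → Bit (ty p) (exCode r d)
  exU : ∀ e < K, 8 * e + 6 < K → ∀ p ∈ D,
    (Bit (ty p) (8 * e + 6) ↔ ∃ q ∈ D, Bit (ty q) e)
  refl : σ.refl → ∀ i < σ.mods, ∀ e < K, diaCode σ.mods i e < K → ∀ p ∈ D,
    Bit (ty p) e → Bit (ty p) (diaCode σ.mods i e)

/-- An element of type `t` at a successor is evidence for the `i`-diamond of the concept `e`. -/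
def Hit (σ : Spec) (t i e : ℕ) : Prop :=
  Bit t e ∨ (σ.base ≤ i ∧ Bit t (diaCode σ.mods i e))

/-- The successor relation of index `h` contributes to the modal operator `i`. -/
def Relevant (σ : Spec) (h i : ℕ) : Prop := i = h ∨ σ.base ≤ i

/-- The state `s'` can be a successor of the state `s` along the successor relation of index `h`,
where the elements of `s` are the first elements of `s'`. -/
def Compat (σ : Spec) (K h : ℕ) (s s' : ℕ × ℕ) : Prop :=
  s.1 ≤ s'.1 ∧ ∀ p < s.1, ∀ i < σ.mods, ∀ e < K, diaCode σ.mods i e < K → Relevant σ h i →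
    Hit σ (row K s' p) i e → Bit (row K s p) (diaCode σ.mods i e)

/-- The state `s'` is a successor of the state `s` that is a witness for the `i`-diamond of the
concept `e` at the `p`-th element. -/
def IsWitness (σ : Spec) (K : ℕ) (s s' : ℕ × ℕ) (p i e : ℕ) : Prop :=
  ∃ h < σ.steps, Relevant σ h i ∧ Compat σ K h s s' ∧ Hit σ (row K s' p) i e

/-- The `p`-th element of the state `s` needs a successor as a witness for the `i`-diamond of the
concept `e`. -/
def Requires (σ : Spec) (K : ℕ) (s : ℕ × ℕ) (p i e : ℕ) : Prop :=
  diaCode σ.mods i e < K ∧ Bit (row K s p) (diaCode σ.mods i e) ∧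
    ¬ (σ.refl ∧ Bit (row K s p) e)

/-- The state `s` is locally consistent. -/
abbrev StateOK (σ : Spec) (K : ℕ) (O : List (ℕ × ℕ)) (s : ℕ × ℕ) : Prop :=
  LocalOK σ K O {p | p < s.1} (row K s)

/-- The states in the list `L` are locally consistent and have all required witnesses among the
later states of the list. -/
def Coherent (σ : Spec) (K : ℕ) (O : List (ℕ × ℕ)) (L : List (ℕ × ℕ)) : Prop :=
  ∀ j < L.length, StateOK σ K O (L.getD j 0) ∧
    ∀ p < (L.getD j 0).1, ∀ i < σ.mods, ∀ e < K, Requires σ K (L.getD j 0) p i e →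
      ∃ k < L.length, j < k ∧ IsWitness σ K (L.getD j 0) (L.getD k 0) p i e

/-- All Gödel numbers of the input are less than `K`. -/
def Bounds (K C : ℕ) (O : List (ℕ × ℕ)) : Prop :=
  C < K ∧ ∀ q ∈ O, q.1 < K ∧ q.2 < K

/-- The concept `C` is nonempty at the state `s`. -/
def Realizes (K C : ℕ) (s : ℕ × ℕ) : Prop := ∃ p < s.1, Bit (row K s p) C

/-- A certificate for satisfiability. -/
def SatCert (σ : Spec) (C : ℕ) (O : List (ℕ × ℕ)) (K : ℕ) (L : List (ℕ × ℕ)) : Prop :=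
  Bounds K C O ∧ Coherent σ K O L ∧ ∃ s ∈ L, Realizes K C s

/-- The number of elements of type `t` in the state `s`. -/
def mult (K t : ℕ) (s : ℕ × ℕ) : ℕ := ((List.range s.1).filter fun p => row K s p = t).length

/-- The state `s` arises from the state `s'` by omitting elements whose type has at least two further
occurrences. -/
def Below (K : ℕ) (s s' : ℕ × ℕ) : Prop :=
  ∀ t < 2 ^ K, mult K t s ≤ mult K t s' ∧ (0 < mult K t s' → 0 < mult K t s) ∧
    (1 < mult K t s' → 1 < mult K t s)

/-- The state `s` is in the upward closed set generated by the list `B`. -/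
def Excluded (K : ℕ) (B : List (ℕ × ℕ)) (s : ℕ × ℕ) : Prop := ∃ b ∈ B, Below K b s

/-- A certificate for unsatisfiability: a finite basis of an upward closed set of states that are not
realized in any model. -/
def UnsatCert (σ : Spec) (C : ℕ) (O : List (ℕ × ℕ)) (K : ℕ) (B : List (ℕ × ℕ)) : Prop :=
  Bounds K C O ∧
  (∀ b ∈ B, StateOK σ K O b → ∃ p < b.1, ∃ i < σ.mods, ∃ e < K, Requires σ K b p i e ∧
    ∀ l < b.1 + 2 * 2 ^ K + 1, ∀ x < (2 ^ K) ^ l, StateOK σ K O (l, x) →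
      IsWitness σ K b (l, x) p i e → Excluded K B (l, x)) ∧
  ∀ l < 2 * 2 ^ K + 1, ∀ x < (2 ^ K) ^ l, StateOK σ K O (l, x) → Realizes K C (l, x) →
    Excluded K B (l, x)

/-! ### Certificates are primitive recursively checkable -/

section Primrec

variable {α : Type*} [Primcodable α] {σ : Spec}

@[fun_prop]
theorem primrec_row {K p : α → ℕ} {s : α → ℕ × ℕ} (hK : Primrec K) (hs : Primrec s)
    (hp : Primrec p) : Primrec fun a => row (K a) (s a) (p a) := by
  unfold row; fun_prop

@[fun_prop]
theorem primrec_andCode {f g : α → ℕ} (hf : Primrec f) (hg : Primrec g) :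
    Primrec fun a => andCode (f a) (g a) := by
  unfold andCode; fun_prop

@[fun_prop]
theorem primrec_exCode {f g : α → ℕ} (hf : Primrec f) (hg : Primrec g) :
    Primrec fun a => exCode (f a) (g a) := by
  unfold exCode; fun_prop

@[fun_prop]
theorem primrec_diaCode {m f g : α → ℕ} (hm : Primrec m) (hf : Primrec f) (hg : Primrec g) :
    Primrec fun a => diaCode (m a) (f a) (g a) := by
  unfold diaCode; fun_prop

@[fun_prop]
theorem primrec_mult {K t : α → ℕ} {s : α → ℕ × ℕ} (hK : Primrec K) (ht : Primrec t)
    (hs : Primrec s) : Primrec fun a => mult (K a) (t a) (s a) := by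
  unfold mult
  exact Primrec.count_lt (by fun_prop) (.nat_eq_comp (by fun_prop) (by fun_prop))

theorem primrecPred_bit {t c : α → ℕ} (ht : Primrec t) (hc : Primrec c) :
    PrimrecPred fun a => Bit (t a) (c a) := by
  unfold Bit
  exact .nat_eq_comp (by fun_prop) (by fun_prop)

theorem primrecPred_hit {t i e : α → ℕ} (ht : Primrec t) (hi : Primrec i) (he : Primrec e) :
    PrimrecPred fun a => Hit σ (t a) (i a) (e a) := by
  unfold Hit
  exact (primrecPred_bit ht he).or
    ((PrimrecPred.nat_le_comp (by fun_prop) hi).and (primrecPred_bit ht (by fun_prop)))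

theorem primrecPred_relevant {h i : α → ℕ} (hh : Primrec h) (hi : Primrec i) :
    PrimrecPred fun a => Relevant σ (h a) (i a) := by
  unfold Relevant
  exact (PrimrecPred.nat_eq_comp hi hh).or (.nat_le_comp (by fun_prop) hi)

theorem primrecPred_compat {K h : α → ℕ} {s s' : α → ℕ × ℕ} (hK : Primrec K) (hh : Primrec h)
    (hs : Primrec s) (hs' : Primrec s') :
    PrimrecPred fun a => Compat σ (K a) (h a) (s a) (s' a) := by
  unfold Compat
  repeat' first
    | exact primrecPred_bit (by fun_prop) (by fun_prop)
    | exact primrecPred_hit (by fun_prop) (by fun_prop) (by fun_prop)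
    | exact primrecPred_relevant (by fun_prop) (by fun_prop)
    | exact .nat_lt_comp (by fun_prop) (by fun_prop)
    | exact .nat_le_comp (by fun_prop) (by fun_prop)
    | refine PrimrecPred.and ?_ ?_
    | refine PrimrecPred.ball_lt (by fun_prop) ?_
    | refine PrimrecPred.imp ?_ ?_

theorem primrecPred_isWitness {K p i e : α → ℕ} {s s' : α → ℕ × ℕ} (hK : Primrec K)
    (hs : Primrec s) (hs' : Primrec s') (hp : Primrec p) (hi : Primrec i) (he : Primrec e) :
    PrimrecPred fun a => IsWitness σ (K a) (s a) (s' a) (p a) (i a) (e a) := by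
  unfold IsWitness
  refine PrimrecPred.bex_lt (by fun_prop) (PrimrecPred.and ?_ (PrimrecPred.and ?_ ?_))
  · exact primrecPred_relevant (by fun_prop) (by fun_prop)
  · exact primrecPred_compat (by fun_prop) (by fun_prop) (by fun_prop) (by fun_prop)
  · exact primrecPred_hit (by fun_prop) (by fun_prop) (by fun_prop)

theorem primrecPred_requires {K p i e : α → ℕ} {s : α → ℕ × ℕ} (hK : Primrec K)
    (hs : Primrec s) (hp : Primrec p) (hi : Primrec i) (he : Primrec e) :
    PrimrecPred fun a => Requires σ (K a) (s a) (p a) (i a) (e a) := by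
  unfold Requires
  refine (PrimrecPred.nat_lt_comp (by fun_prop) hK).and
    (PrimrecPred.and ?_ (PrimrecPred.not (PrimrecPred.and (.const_prop _) ?_)))
  · exact primrecPred_bit (by fun_prop) (by fun_prop)
  · exact primrecPred_bit (by fun_prop) (by fun_prop)

theorem primrecPred_stateOK {K : α → ℕ} {O : α → List (ℕ × ℕ)} {s : α → ℕ × ℕ} (hK : Primrec K)
    (hO : Primrec O) (hs : Primrec s) : PrimrecPred fun a => StateOK σ (K a) (O a) (s a) := by
  -- The structure is unbundled into a conjunction of bounded quantifiers, with nonemptiness also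
  -- written as one, so that the closure lemmas apply.
  have key : ∀ a, StateOK σ (K a) (O a) (s a) ↔ (∃ p < (s a).1, True) ∧ _ :=
    fun a => ⟨fun h => And.intro (h.nonempty.imp fun _ hp => ⟨hp, trivial⟩) <| And.intro h.onto <| And.intro h.nom <|
      And.intro h.nom_total <| And.intro h.desc <| And.intro h.neg <| And.intro h.and <|
      And.intro h.ex <| And.intro h.exU h.refl,
      fun ⟨⟨p, hp, _⟩, h2, h3, h4, h5, h6, h7, h8, h9, h10⟩ =>
        ⟨⟨p, hp⟩, h2, h3, h4, h5, h6, h7, h8, h9, h10⟩⟩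
  refine PrimrecPred.of_eq ?_ fun a => (key a).symm
  simp only [Set.mem_ofPred_eq]
  repeat' first
    | exact PrimrecPred.const_prop _
    | exact primrecPred_bit (by fun_prop) (by fun_prop)
    | exact .nat_lt_comp (by fun_prop) (by fun_prop)
    | exact .nat_eq_comp (by fun_prop) (by fun_prop)
    | refine PrimrecPred.and ?_ ?_
    | refine PrimrecPred.iff ?_ ?_
    | refine PrimrecPred.not ?_
    | refine PrimrecPred.ball_lt (by fun_prop) ?_
    | refine PrimrecPred.bex_lt (by fun_prop) ?_
    | refine PrimrecPred.ball_mem (by fun_prop) ?_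
    | refine PrimrecPred.imp ?_ ?_

theorem primrecPred_realizes {K C : α → ℕ} {s : α → ℕ × ℕ} (hK : Primrec K) (hC : Primrec C)
    (hs : Primrec s) : PrimrecPred fun a => Realizes (K a) (C a) (s a) := by
  unfold Realizes
  exact PrimrecPred.bex_lt (by fun_prop) (primrecPred_bit (by fun_prop) (by fun_prop))

theorem primrecPred_bounds {K C : α → ℕ} {O : α → List (ℕ × ℕ)} (hK : Primrec K)
    (hC : Primrec C) (hO : Primrec O) : PrimrecPred fun a => Bounds (K a) (C a) (O a) := by
  unfold Bounds
  refine PrimrecPred.and (.nat_lt_comp hC hK) (PrimrecPred.ball_mem hO (PrimrecPred.and ?_ ?_))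
  · exact .nat_lt_comp (by fun_prop) (by fun_prop)
  · exact .nat_lt_comp (by fun_prop) (by fun_prop)

theorem primrecPred_excluded {K : α → ℕ} {B : α → List (ℕ × ℕ)} {s : α → ℕ × ℕ} (hK : Primrec K)
    (hB : Primrec B) (hs : Primrec s) : PrimrecPred fun a => Excluded (K a) (B a) (s a) := by
  unfold Excluded Below
  repeat' first
    | exact .nat_lt_comp (by fun_prop) (by fun_prop)
    | exact .nat_le_comp (by fun_prop) (by fun_prop)
    | refine PrimrecPred.and ?_ ?_
    | refine PrimrecPred.ball_lt (by fun_prop) ?_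
    | refine PrimrecPred.bex_mem (by fun_prop) ?_
    | refine PrimrecPred.imp ?_ ?_

theorem primrecPred_satCert {C K : α → ℕ} {O L : α → List (ℕ × ℕ)} (hC : Primrec C)
    (hO : Primrec O) (hK : Primrec K) (hL : Primrec L) :
    PrimrecPred fun a => SatCert σ (C a) (O a) (K a) (L a) := by
  unfold SatCert Coherent
  repeat' first
    | exact primrecPred_bounds (by fun_prop) (by fun_prop) (by fun_prop)
    | exact primrecPred_stateOK (by fun_prop) (by fun_prop) (by fun_prop)
    | exact primrecPred_realizes (by fun_prop) (by fun_prop) (by fun_prop)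
    | exact primrecPred_requires (by fun_prop) (by fun_prop) (by fun_prop) (by fun_prop)
        (by fun_prop)
    | exact primrecPred_isWitness (by fun_prop) (by fun_prop) (by fun_prop) (by fun_prop)
        (by fun_prop) (by fun_prop)
    | exact .nat_lt_comp (by fun_prop) (by fun_prop)
    | refine PrimrecPred.and ?_ ?_
    | refine PrimrecPred.ball_lt (by fun_prop) ?_
    | refine PrimrecPred.bex_lt (by fun_prop) ?_
    | refine PrimrecPred.bex_mem (by fun_prop) ?_
    | refine PrimrecPred.imp ?_ ?_

theorem primrecPred_unsatCert {C K : α → ℕ} {O B : α → List (ℕ × ℕ)} (hC : Primrec C)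
    (hO : Primrec O) (hK : Primrec K) (hB : Primrec B) :
    PrimrecPred fun a => UnsatCert σ (C a) (O a) (K a) (B a) := by
  unfold UnsatCert
  repeat' first
    | exact primrecPred_bounds (by fun_prop) (by fun_prop) (by fun_prop)
    | exact primrecPred_stateOK (by fun_prop) (by fun_prop) (by fun_prop)
    | exact primrecPred_realizes (by fun_prop) (by fun_prop) (by fun_prop)
    | exact primrecPred_excluded (by fun_prop) (by fun_prop) (by fun_prop)
    | exact primrecPred_requires (by fun_prop) (by fun_prop) (by fun_prop) (by fun_prop)
        (by fun_prop)
    | exact primrecPred_isWitness (by fun_prop) (by fun_prop) (by fun_prop) (by fun_prop)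
        (by fun_prop) (by fun_prop)
    | refine PrimrecPred.and ?_ ?_
    | refine PrimrecPred.ball_lt (by fun_prop) ?_
    | refine PrimrecPred.bex_lt (by fun_prop) ?_
    | refine PrimrecPred.ball_mem (by fun_prop) ?_
    | refine PrimrecPred.imp ?_ ?_

/-- Post's theorem: both a set and its complement are projections of primitive recursive predicates.
-/
theorem computablePred_of_cert {p : α → Prop} {C : α → ℕ} {O : α → List (ℕ × ℕ)}
    (hC : Primrec C) (hO : Primrec O)
    (hsat : ∀ a, p a ↔ ∃ K L, SatCert σ (C a) (O a) K L)
    (hunsat : ∀ a, ¬ p a ↔ ∃ K B, UnsatCert σ (C a) (O a) K B) : ComputablePred p := by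
  rw [ComputablePred.computable_iff_re_compl_re']
  constructor
  · refine (REPred.exists_of_primrecPred (β := ℕ × List (ℕ × ℕ))
      (p := fun a b => SatCert σ (C a) (O a) b.1 b.2) ?_).of_eq fun a => ?_
    · exact primrecPred_satCert (by fun_prop) (by fun_prop) (by fun_prop) (by fun_prop)
    · rw [hsat, Prod.exists]
  · refine (REPred.exists_of_primrecPred (β := ℕ × List (ℕ × ℕ))
      (p := fun a b => UnsatCert σ (C a) (O a) b.1 b.2) ?_).of_eq fun a => ?_
    · exact primrecPred_unsatCert (by fun_prop) (by fun_prop) (by fun_prop) (by fun_prop)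
    · rw [hunsat, Prod.exists]

end Primrec

/-! ### Embeddings of typed sets -/

/-- The map `f` embeds the typed set `D'` into the typed set `D` in such a way that every type of `D`
that occurs (at least twice) also occurs (at least twice) in `D'`. -/
structure Embeds {α β : Type*} (D' : Set β) (ty' : β → ℕ) (D : Set α) (ty : α → ℕ) (f : β → α) :
    Prop where
  mapsTo : Set.MapsTo f D' D
  injOn : Set.InjOn f D'
  ty_eq : ∀ p ∈ D', ty (f p) = ty' p
  once : ∀ q ∈ D, ∃ p ∈ D', ty' p = ty q
  twice : ∀ q ∈ D, ∀ r ∈ D, q ≠ r → ty q = ty r →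
    ∃ p ∈ D', ∃ p' ∈ D', p ≠ p' ∧ ty' p = ty q ∧ ty' p' = ty q

theorem Embeds.comp {α β γ : Type*} {D'' : Set γ} {ty'' : γ → ℕ} {D' : Set β} {ty' : β → ℕ}
    {D : Set α} {ty : α → ℕ} {f : β → α} {g : γ → β} (hf : Embeds D' ty' D ty f)
    (hg : Embeds D'' ty'' D' ty' g) : Embeds D'' ty'' D ty (f ∘ g) where
  mapsTo := hf.mapsTo.comp hg.mapsTo
  injOn := hf.injOn.comp hg.injOn hg.mapsTo
  ty_eq p hp := (hf.ty_eq _ (hg.mapsTo hp)).trans (hg.ty_eq p hp)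
  once q hq := by
    obtain ⟨p, hp, hpq⟩ := hf.once q hq
    obtain ⟨r, hr, hrp⟩ := hg.once p hp
    exact ⟨r, hr, hrp.trans hpq⟩
  twice q hq r hr hne heq := by
    obtain ⟨p, hp, p', hp', hpne, h1, h2⟩ := hf.twice q hq r hr hne heq
    obtain ⟨u, hu, u', hu', hune, h3, h4⟩ := hg.twice p hp p' hp' hpne (h1.trans h2.symm)
    exact ⟨u, hu, u', hu', hune, h3.trans h1, h4.trans h1⟩

section

variable {σ : Spec} {K : ℕ} {O : List (ℕ × ℕ)} {α β : Type*} {D' : Set β} {ty' : β → ℕ}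
  {D : Set α} {ty : α → ℕ} {f : β → α}

theorem Embeds.exists_bit_iff (hf : Embeds D' ty' D ty f) (e : ℕ) :
    (∃ q ∈ D', Bit (ty' q) e) ↔ ∃ q ∈ D, Bit (ty q) e := by
  constructor
  · rintro ⟨q, hq, h⟩
    exact ⟨f q, hf.mapsTo hq, by rwa [hf.ty_eq q hq]⟩
  · rintro ⟨q, hq, h⟩
    obtain ⟨p, hp, hpq⟩ := hf.once q hq
    exact ⟨p, hp, by rwa [hpq]⟩

/-- Uniqueness depends on the multiplicities of types only up to two. A second element of the larger
set carrying the bit either has a new type, which `once` copies, or shares the type of `f p`, and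
then `twice` yields two copies. -/
theorem Embeds.forall_bit_eq_iff (hf : Embeds D' ty' D ty f) {p : β} (hp : p ∈ D') (e : ℕ) :
    (∀ q ∈ D', Bit (ty' q) e → q = p) ↔ ∀ q ∈ D, Bit (ty q) e → q = f p := by
  constructor
  · intro h q hq hqe
    by_contra hne
    obtain ⟨r, hr, hrq⟩ := hf.once q hq
    have hrp : r = p := h r hr (by rwa [hrq])
    subst hrp
    obtain ⟨u, hu, u', hu', huu, h1, h2⟩ := hf.twice q hq (f r) (hf.mapsTo hp) hne
      (hrq.symm.trans (hf.ty_eq r hp).symm)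
    exact huu ((h u hu (by rwa [h1])).trans (h u' hu' (by rwa [h2])).symm)
  · intro h q hq hqe
    exact hf.injOn hq hp (h _ (hf.mapsTo hq) (by rwa [hf.ty_eq q hq]))

/-- Nominals and descriptions only compare multiplicities with zero and one. All other conditions
concern single types or ask for an element of a given type, so a lost witness is replaced by a
retained element of its type. -/
theorem LocalOK.of_embeds (h : LocalOK σ K O D ty) (hf : Embeds D' ty' D ty f) :
    LocalOK σ K O D' ty' where
  nonempty := by
    obtain ⟨q, hq⟩ := h.nonempty
    obtain ⟨p, hp, -⟩ := hf.once q hq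
    exact ⟨p, hp⟩
  onto q hq p hp := by
    have := h.onto q hq (f p) (hf.mapsTo hp)
    rwa [hf.ty_eq p hp] at this
  nom a ha ha' p hp q hq h1 h2 := by
    rw [← hf.ty_eq p hp] at h1
    rw [← hf.ty_eq q hq] at h2
    exact hf.injOn hp hq (h.nom a ha ha' _ (hf.mapsTo hp) _ (hf.mapsTo hq) h1 h2)
  nom_total ht a ha ha' := (hf.exists_bit_iff _).2 (h.nom_total ht a ha ha')
  desc e he he' p hp := by
    rw [hf.forall_bit_eq_iff hp, ← hf.ty_eq p hp]
    exact h.desc e he he' _ (hf.mapsTo hp)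
  neg e he he' p hp := by
    rw [← hf.ty_eq p hp]
    exact h.neg e he he' _ (hf.mapsTo hp)
  and d hd e he he' p hp := by
    rw [← hf.ty_eq p hp]
    exact h.and d hd e he he' _ (hf.mapsTo hp)
  ex r hr e he he' p hp := by
    rw [← hf.ty_eq p hp]
    intro hb
    obtain ⟨q, hq, hqe, hqd⟩ := h.ex r hr e he he' _ (hf.mapsTo hp) hb
    obtain ⟨u, hu, huq⟩ := hf.once q hq
    exact ⟨u, hu, by rwa [huq], by rwa [huq]⟩
  exU e he he' p hp := by
    rw [← hf.ty_eq p hp, hf.exists_bit_iff]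
    exact h.exU e he he' _ (hf.mapsTo hp)
  refl hr i hi e he he' p hp := by
    rw [← hf.ty_eq p hp]
    exact h.refl hr i hi e he he' _ (hf.mapsTo hp)

end

/-! ### Finite states inside a typed set -/

section Extend

variable {α : Type*} {D : Set α}

/-- A finite sequence of distinct elements of `D` of length `l`. -/
abbrev IsSeq (D : Set α) (l : ℕ) (f : ℕ → α) : Prop :=
  Set.MapsTo f {p | p < l} D ∧ Set.InjOn f {p | p < l}

theorem IsSeq.exists_extend_mem {l : ℕ} {f : ℕ → α} (hf : IsSeq D l f) {a : α} (ha : a ∈ D) :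
    ∃ l' g, l ≤ l' ∧ l' ≤ l + 1 ∧ IsSeq D l' g ∧ (∀ p < l, g p = f p) ∧ ∃ p < l', g p = a := by
  by_cases h : ∃ p < l, f p = a
  · exact ⟨l, f, le_rfl, Nat.le_succ l, hf, fun _ _ => rfl, h⟩
  push Not at h
  have e : ∀ p < l, Function.update f l a p = f p := fun p hp => Function.update_of_ne hp.ne _ _
  have e' : Function.update f l a l = a := Function.update_self ..
  refine ⟨l + 1, Function.update f l a, Nat.le_succ l, le_rfl, ⟨?_, ?_⟩, e, l, l.lt_succ_self, e'⟩
  · intro p (hp : p < l + 1)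
    rcases Nat.lt_succ_iff_lt_or_eq.1 hp with hp | rfl
    · rw [e p hp]
      exact hf.1 hp
    · rwa [e']
  · intro p (hp : p < l + 1) q (hq : q < l + 1) hpq
    rcases Nat.lt_succ_iff_lt_or_eq.1 hp with hp | rfl <;>
      rcases Nat.lt_succ_iff_lt_or_eq.1 hq with hq | rfl
    · rw [e p hp, e q hq] at hpq
      exact hf.2 hp hq hpq
    · rw [e p hp, e'] at hpq
      exact absurd hpq (h p hp)
    · rw [e q hq, e'] at hpq
      exact absurd hpq.symm (h q hq)
    · rfl

/-- At most two elements are added for each type, which gives the explicit length bound that makes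
the search in `UnsatCert` finite. -/
theorem IsSeq.exists_extend_types {l : ℕ} {f : ℕ → α} (hf : IsSeq D l f) (ty : α → ℕ) (N : ℕ) :
    ∃ l' g, l ≤ l' ∧ l' ≤ l + 2 * N ∧ IsSeq D l' g ∧ (∀ p < l, g p = f p) ∧
      (∀ q ∈ D, ty q < N → ∃ p < l', ty (g p) = ty q) ∧
      ∀ q ∈ D, ∀ r ∈ D, ty q < N → q ≠ r → ty q = ty r →
        ∃ p < l', ∃ p' < l', p ≠ p' ∧ ty (g p) = ty q ∧ ty (g p') = ty q := by
  induction N with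
  | zero => exact ⟨l, f, le_rfl, le_rfl, hf, fun _ _ => rfl, by simp, by simp⟩
  | succ N ih =>
    obtain ⟨l₁, g₁, h1, h2, h3, h4, h5, h6⟩ := ih
    obtain ⟨l₂, g₂, i1, i2, i3, i4, i5, i6⟩ : ∃ l₂ g₂, l₁ ≤ l₂ ∧ l₂ ≤ l₁ + 2 ∧ IsSeq D l₂ g₂ ∧
        (∀ p < l₁, g₂ p = g₁ p) ∧ (∀ q ∈ D, ty q = N → ∃ p < l₂, ty (g₂ p) = N) ∧
        ∀ q ∈ D, ∀ r ∈ D, ty q = N → q ≠ r → ty r = N →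
          ∃ p < l₂, ∃ p' < l₂, p ≠ p' ∧ ty (g₂ p) = N ∧ ty (g₂ p') = N := by
      -- Two elements of type `N` are secured if there are two, one if there is just one, and none
      -- otherwise.
      by_cases hA : ∃ q ∈ D, ∃ r ∈ D, ty q = N ∧ q ≠ r ∧ ty r = N
      · obtain ⟨q, hq, r, hr, hqN, hne, hrN⟩ := hA
        obtain ⟨l₂, g₂, j1, j2, j3, j4, p, hp, hpq⟩ := h3.exists_extend_mem hq
        obtain ⟨l₃, g₃, k1, k2, k3, k4, p', hp', hpr⟩ := j3.exists_extend_mem hr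
        have hpq' : g₃ p = q := (k4 p hp).trans hpq
        refine ⟨l₃, g₃, by omega, by omega, k3,
          fun x hx => (k4 x (by omega)).trans (j4 x hx), fun _ _ _ => ⟨p, by omega, by rw [hpq', hqN]⟩,
          fun _ _ _ _ _ _ _ => ⟨p, by omega, p', hp', ?_, by rw [hpq', hqN], by rw [hpr, hrN]⟩⟩
        rintro rfl
        exact hne (hpq'.symm.trans hpr)
      · by_cases hB : ∃ q ∈ D, ty q = N
        · obtain ⟨q, hq, hqN⟩ := hB
          obtain ⟨l₂, g₂, j1, j2, j3, j4, p, hp, hpq⟩ := h3.exists_extend_mem hq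
          exact ⟨l₂, g₂, j1, by omega, j3, j4, fun _ _ _ => ⟨p, hp, by rw [hpq, hqN]⟩,
            fun q hq r hr h h' h'' => absurd ⟨q, hq, r, hr, h, h', h''⟩ hA⟩
        · exact ⟨l₁, g₁, le_rfl, by omega, h3, fun _ _ => rfl,
            fun q hq h => absurd ⟨q, hq, h⟩ hB, fun q hq _ _ h => absurd ⟨q, hq, h⟩ hB⟩
    refine ⟨l₂, g₂, h1.trans i1, by omega, i3,
      fun p hp => (i4 p (by omega)).trans (h4 p hp), fun q hq hqN => ?_,
      fun q hq r hr hqN hne heq => ?_⟩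
    · rcases Nat.lt_succ_iff_lt_or_eq.1 hqN with hlt | hlt
      · obtain ⟨p, hp, hpq⟩ := h5 q hq hlt
        exact ⟨p, by omega, by rwa [i4 p hp]⟩
      · rw [hlt]
        exact i5 q hq hlt
    · rcases Nat.lt_succ_iff_lt_or_eq.1 hqN with hlt | hlt
      · obtain ⟨p, hp, p', hp', hpp, e1, e2⟩ := h6 q hq r hr hlt hne heq
        exact ⟨p, by omega, p', by omega, hpp, by rwa [i4 p hp], by rwa [i4 p' hp']⟩
      · rw [hlt]
        exact i6 q hq r hr hlt hne (heq.symm.trans hlt)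

end Extend

/-- Every sequence of types is the sequence of types of a finite state. -/
theorem exists_state (K l : ℕ) (ty : ℕ → ℕ) (hty : ∀ p < l, ty p < 2 ^ K) :
    ∃ x < (2 ^ K) ^ l, ∀ p < l, row K (l, x) p = ty p := by
  suffices h : ∃ x < (2 ^ K) ^ l, ∀ p < l, x / (2 ^ K) ^ p % 2 ^ K = ty p from h
  induction l with
  | zero => exact ⟨0, by simp, by simp⟩
  | succ l ih =>
    obtain ⟨x, hx, h⟩ := ih fun p hp => hty p (by omega)
    have hpos : 0 < 2 ^ K := by positivity
    have htl := hty l (by omega)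
    refine ⟨x + (2 ^ K) ^ l * ty l, ?_, fun p hp => ?_⟩
    · calc x + (2 ^ K) ^ l * ty l < (2 ^ K) ^ l + (2 ^ K) ^ l * ty l := by omega
        _ = (2 ^ K) ^ l * (ty l + 1) := by ring
        _ ≤ (2 ^ K) ^ l * 2 ^ K := Nat.mul_le_mul_left _ htl
        _ = (2 ^ K) ^ (l + 1) := (pow_succ ..).symm
    · rcases Nat.lt_succ_iff_lt_or_eq.1 hp with hp | rfl
      · obtain ⟨d, rfl⟩ := Nat.exists_eq_add_of_lt hp
        -- The new leading digit contributes a multiple of `(2 ^ K) ^ (p + 1)`, so it leaves the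
        -- digit at `p` unchanged.
        have : (2 ^ K) ^ (p + d + 1) * ty (p + d + 1) =
            (2 ^ K) ^ p * (2 ^ K * ((2 ^ K) ^ d * ty (p + d + 1))) := by ring
        rw [this, Nat.add_mul_div_left _ _ (by positivity), Nat.add_mul_mod_self_left, h p hp]
      · rw [Nat.add_mul_div_left _ _ (by positivity), Nat.div_eq_of_lt hx, zero_add,
          Nat.mod_eq_of_lt htl]

theorem row_lt (K : ℕ) (s : ℕ × ℕ) (p : ℕ) : row K s p < 2 ^ K :=
  Nat.mod_lt _ (by positivity)

/-- A sequence of distinct elements of a typed set extends to a state that embeds into the set. -/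
theorem exists_state_embeds {α : Type*} {D : Set α} {ty : α → ℕ} {K l : ℕ}
    (hty : ∀ q ∈ D, ty q < 2 ^ K) {f : ℕ → α} (hf : IsSeq D l f) :
    ∃ l' x g, l ≤ l' ∧ l' ≤ l + 2 * 2 ^ K ∧ x < (2 ^ K) ^ l' ∧ (∀ p < l, g p = f p) ∧
      Embeds {p | p < l'} (row K (l', x)) D ty g := by
  obtain ⟨l', g, h1, h2, h3, h4, h5, h6⟩ := hf.exists_extend_types ty (2 ^ K)
  obtain ⟨x, hx, hrow⟩ := exists_state K l' (ty ∘ g) fun p hp => hty _ (h3.1 hp)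
  refine ⟨l', x, g, h1, h2, hx, h4, h3.1, h3.2, fun p hp => (hrow p hp).symm, fun q hq => ?_,
    fun q hq r hr hne heq => ?_⟩
  · obtain ⟨p, hp, hpq⟩ := h5 q hq (hty q hq)
    exact ⟨p, hp, (hrow p hp).trans hpq⟩
  · obtain ⟨p, hp, p', hp', hne, e1, e2⟩ := h6 q hq r hr (hty q hq) hne heq
    exact ⟨p, hp, p', hp', hne, (hrow p hp).trans e1, (hrow p' hp').trans e2⟩

/-! ### The order on states and Dickson's lemma -/

theorem mult_eq_card (K t : ℕ) (s : ℕ × ℕ) :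
    mult K t s = ((Finset.range s.1).filter fun p => row K s p = t).card := by
  rw [mult, ← List.toFinset_card_of_nodup (List.nodup_range.filter _)]
  congr 1
  ext p
  simp

/-- The multiplicity inequality injects each type class separately. The injections glue because they
preserve types, so images from different classes are distinct. -/
theorem Below.exists_embeds {K : ℕ} {s s' : ℕ × ℕ} (h : Below K s s') :
    ∃ f, Embeds {p | p < s.1} (row K s) {p | p < s'.1} (row K s') f := by
  simp only [Below, mult_eq_card] at h
  have hfib : ∀ t, ∃ f : ℕ → ℕ,
      Set.MapsTo f ((Finset.range s.1).filter fun p => row K s p = t : Finset ℕ)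
        ((Finset.range s'.1).filter fun p => row K s' p = t : Finset ℕ) ∧
      Set.InjOn f ((Finset.range s.1).filter fun p => row K s p = t : Finset ℕ) := by
    intro t
    by_cases ht : t < 2 ^ K
    · have hcard := (h t ht).1
      rw [← Nat.cast_le (α := ℕ∞), ← Set.encard_coe_eq_coe_finsetCard,
        ← Set.encard_coe_eq_coe_finsetCard] at hcard
      obtain ⟨f, hf, hf'⟩ := Set.Finite.exists_injOn_of_encard_le (Finset.finite_toSet _) hcard
      exact ⟨f, fun p hp => hf hp, hf'⟩
    · refine ⟨id, fun p hp => absurd (row_lt K s p) ?_, Function.injective_id.injOn⟩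
      simp only [Finset.coe_filter, Finset.mem_range, Set.mem_ofPred_eq] at hp
      rwa [hp.2]
  choose f hmaps hinj using hfib
  have hf : ∀ p < s.1, f (row K s p) p < s'.1 ∧ row K s' (f (row K s p) p) = row K s p := by
    intro p hp
    have := hmaps (row K s p) (x := p) (by simpa using hp)
    simpa using this
  refine ⟨fun p => f (row K s p) p, fun p hp => (hf p hp).1, ?_, fun p hp => (hf p hp).2, ?_, ?_⟩
  · intro p (hp : p < s.1) q (hq : q < s.1) heq
    have hr : row K s p = row K s q := by
      rw [← (hf p hp).2, ← (hf q hq).2]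
      exact congrArg _ heq
    refine hinj (row K s p) (by simpa using hp) (by simpa [hr] using hq) ?_
    simpa only [hr] using heq
  · intro q (hq : q < s'.1)
    obtain ⟨p, hp⟩ := Finset.card_pos.1 ((h _ (row_lt K s' q)).2.1 (Finset.card_pos.2 ⟨q, by simpa⟩))
    simp only [Finset.mem_filter, Finset.mem_range] at hp
    exact ⟨p, hp⟩
  · intro q (hq : q < s'.1) r (hr : r < s'.1) hne heq
    obtain ⟨p, hp, p', hp', hpp⟩ := Finset.one_lt_card.1 ((h _ (row_lt K s' q)).2.2
      (Finset.one_lt_card.2 ⟨q, by simpa, r, by simpa [heq] using hr, hne⟩))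
    simp only [Finset.mem_filter, Finset.mem_range] at hp hp'
    exact ⟨p, hp.1, p', hp'.1, hpp, hp.2, hp'.2⟩

/-- By Dickson's lemma, every set of states is contained in the upward closed set generated by
finitely many of its elements. -/
theorem exists_finite_basis (K : ℕ) (U : Set (ℕ × ℕ)) :
    ∃ B : List (ℕ × ℕ), (∀ b ∈ B, b ∈ U) ∧ ∀ s ∈ U, Excluded K B s := by
  by_contra hcon
  push Not at hcon
  have hstep : ∀ B : Finset (ℕ × ℕ), (∀ b ∈ B, b ∈ U) →
      ∃ s, s ∈ U ∧ ∀ b ∈ B, ¬ Below K b s := by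
    intro B hB
    obtain ⟨s, hs, hsB⟩ := hcon B.toList (by simpa using hB)
    exact ⟨s, hs, fun b hb hbs => hsB ⟨b, by simpa using hb, hbs⟩⟩
  -- Without a finite basis there is a sequence in which no state lies below a later one.
  obtain ⟨f, -, hf⟩ := exists_seq_of_forall_finset_exists (· ∈ U) (fun b s => ¬ Below K b s) hstep
  -- The truncated difference reverses the order, so `v j ≤ v k` makes the multiplicities increase
  -- while agreeing once capped at two.
  let v : ℕ → Fin (2 ^ K) → ℕ × ℕ := fun k t => (mult K t (f k), 2 - mult K t (f k))
  obtain ⟨j, k, hjk, hle⟩ := wellQuasiOrdered_le v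
  refine hf j k hjk fun t ht => ?_
  have := hle ⟨t, ht⟩
  simp only [v, Prod.mk_le_mk] at this
  omega

/-! ### Subconcept codes and the shape of frame classes -/

theorem left_lt_of_andCode_lt {K d e : ℕ} (h : andCode d e < K) : d < K := by
  have := Nat.left_le_pair d e
  unfold andCode at h
  omega

theorem right_lt_of_andCode_lt {K d e : ℕ} (h : andCode d e < K) : e < K := by
  have := Nat.right_le_pair d e
  unfold andCode at h
  omega

theorem left_lt_of_exCode_lt {K r e : ℕ} (h : exCode r e < K) : r < K := by
  have := Nat.left_le_pair r e
  unfold exCode at h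
  omega

theorem right_lt_of_exCode_lt {K r e : ℕ} (h : exCode r e < K) : e < K := by
  have := Nat.right_le_pair r e
  unfold exCode at h
  omega

theorem lt_of_diaCode_lt {K m i e : ℕ} (hm : 0 < m) (h : diaCode m i e < K) : e < K := by
  have := Nat.le_mul_of_pos_left e hm
  unfold diaCode at h
  omega

/-- The relations `E` are related to the accessibility relations `R` as described by `σ`. -/
def StepEq (σ : Spec) {W : Type} (R : Fin σ.mods → W → W → Prop) (E : ℕ → W → W → Prop) : Prop :=
  ∀ i w (X : W → Prop), (∃ v, R i w v ∧ X v) ↔ (σ.refl ∧ X w) ∨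
    ∃ h < σ.steps, ∃ v, E h w v ∧ Relevant σ h i ∧ (X v ∨ σ.base ≤ i ∧ ∃ u, R i v u ∧ X u)

/-- The class `𝒞` of frames has the shape `σ`: frames in `𝒞` are given by conversely well-founded
successor relations, and any acyclic successor relations on a finite set give a frame in `𝒞`. -/
structure Describes (σ : Spec) (𝒞 : Set (Frame σ.mods)) : Prop where
  unfold : ∀ F ∈ 𝒞, ∃ E : ℕ → F.World → F.World → Prop,
    WellFounded (fun v w => ∃ h < σ.steps, E h w v) ∧
    (∀ h < σ.steps, ∀ w v, E h w v → ∃ i, F.R i w v) ∧ StepEq σ F.R E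
  build : ∀ (N : ℕ) (hN : Nonempty (Fin N)) (E : ℕ → Fin N → Fin N → Prop),
    (∀ h j k, E h j k → j < k) → ∃ R : Fin σ.mods → Fin N → Fin N → Prop,
      (⟨Fin N, hN, R⟩ : Frame σ.mods) ∈ 𝒞 ∧
      (∀ i j k, R i j k → Relation.ReflTransGen (fun j k => ∃ h < σ.steps, E h j k) j k) ∧
      StepEq σ R E

/-- Satisfiability over the class `𝒞`, in total interpretations if `σ` asks for them. -/
def SpecSatisfiable (σ : Spec) (𝒞 : Set (Frame σ.mods)) (C : Concept σ.mods)
    (O : Ontology σ.mods) : Prop :=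
  ∃ F ∈ 𝒞, ∃ M : PartialInterpretation F,
    (σ.total → M.IsTotal) ∧ M.Models O ∧ ∃ w, (M.ext C w).Nonempty

/-- The Gödel numbers of the concept inclusions in an ontology. -/
def Ontology.codes {m : ℕ} (O : Ontology m) : List (ℕ × ℕ) :=
  O.map fun q => (q.1.encode, q.2.encode)

theorem PartialInterpretation.ext_subset_dom {m : ℕ} {F : Frame m} (M : PartialInterpretation F)
    (C : Concept m) (w : F.World) : M.ext C w ⊆ M.dom w := by
  induction C with
  | name A => exact M.conceptName_subset w A
  | nom a => exact fun d hd => M.individual_mem w a d hd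
  | desc C ih =>
    intro d (hd : M.ext C w = {d})
    exact ih (hd ▸ Set.mem_singleton d)
  | neg C => exact fun d hd => hd.1
  | and C D ihC => exact fun d hd => ihC hd.1
  | ex r C => exact fun d hd => hd.1
  | exU C => exact fun d hd => hd.1
  | dia i C => exact fun d hd => hd.1

/-! ### From positive certificates to models -/

section Soundness

variable {σ : Spec}

open Classical in
/-- The interpretation with the states of a coherent list as worlds. -/
noncomputable def stateInterpretation (K : ℕ) (L : List (ℕ × ℕ)) (hN : Nonempty (Fin L.length))
    (R : Fin σ.mods → Fin L.length → Fin L.length → Prop)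
    (hpos : ∀ j : Fin L.length, 0 < (L.getD j 0).1)
    (hR : ∀ i j k, R i j k → (L.getD j 0).1 ≤ (L.getD k 0).1) :
    PartialInterpretation (⟨Fin L.length, hN, R⟩ : Frame σ.mods) where
  Carrier := ℕ
  dom := fun (j : Fin L.length) => {p | p < (L.getD j 0).1}
  dom_nonempty := fun (j : Fin L.length) => ⟨0, hpos j⟩
  expanding := fun i (j : Fin L.length) (k : Fin L.length) h _ hp => lt_of_lt_of_le hp (hR i j k h)
  conceptName := fun (j : Fin L.length) A =>
    {p | p < (L.getD j 0).1 ∧ Bit (row K (L.getD j 0) p) (8 * A)}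
  conceptName_subset := fun _ _ _ hp => hp.1
  -- This is the largest relation compatible with the types: a pair is excluded only if it would
  -- create an `r`-restriction missing from the type of its source.
  roleName := fun (j : Fin L.length) r p q => p < (L.getD j 0).1 ∧ q < (L.getD j 0).1 ∧
    ∀ d < K, exCode r d < K → Bit (row K (L.getD j 0) q) d →
      Bit (row K (L.getD j 0) p) (exCode r d)
  roleName_dom := fun _ _ _ _ h => ⟨h.1, h.2.1⟩
  individual := fun (j : Fin L.length) a =>
    if h : ∃ p < (L.getD j 0).1, 8 * a + 1 < K ∧ Bit (row K (L.getD j 0) p) (8 * a + 1) then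
      some h.choose
    -- The default only matters for names whose code is not below `K`; for the others `nom_total`
    -- provides an element.
    else if σ.total then some 0 else none
  individual_mem := by
    intro (j : Fin L.length) a d hd
    split_ifs at hd with h1 h2
    · cases hd
      exact h1.choose_spec.1
    · cases hd
      exact hpos j

theorem stateInterpretation_isTotal {K : ℕ} {L : List (ℕ × ℕ)} {hN : Nonempty (Fin L.length)}
    {R : Fin σ.mods → Fin L.length → Fin L.length → Prop}
    {hpos : ∀ j : Fin L.length, 0 < (L.getD j 0).1}
    {hR : ∀ i j k, R i j k → (L.getD j 0).1 ≤ (L.getD k 0).1} (ht : σ.total) :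
    (stateInterpretation K L hN R hpos hR).IsTotal := by
  intro j a
  simp only [stateInterpretation, ht, if_true]
  split_ifs <;> rfl

/-- The extension of a concept in `stateInterpretation`, as a set of natural numbers. -/
def stateExt (K : ℕ) (L : List (ℕ × ℕ)) (hN : Nonempty (Fin L.length))
    (R : Fin σ.mods → Fin L.length → Fin L.length → Prop)
    (hpos : ∀ j : Fin L.length, 0 < (L.getD j 0).1)
    (hR : ∀ i j k, R i j k → (L.getD j 0).1 ≤ (L.getD k 0).1) (C : Concept σ.mods)
    (j : Fin L.length) : Set ℕ := (stateInterpretation K L hN R hpos hR).ext C j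

/-- Truth lemma: membership in the constructed model agrees with the bits of the types for all
concepts with code below `K`. -/
theorem mem_ext_stateInterpretation {K : ℕ} {O L : List (ℕ × ℕ)} (hL : Coherent σ K O L)
    {hN : Nonempty (Fin L.length)} {R : Fin σ.mods → Fin L.length → Fin L.length → Prop}
    {hpos : ∀ j : Fin L.length, 0 < (L.getD j 0).1}
    {hR : ∀ i j k, R i j k → (L.getD j 0).1 ≤ (L.getD k 0).1}
    (hE : StepEq σ R fun h j k => j < k ∧ Compat σ K h (L.getD j 0) (L.getD k 0))
    (C : Concept σ.mods) (hC : C.encode < K) (j : Fin L.length) (p : ℕ) :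
    p ∈ stateExt K L hN R hpos hR C j ↔
      p < (L.getD j 0).1 ∧ Bit (row K (L.getD j 0) p) C.encode := by
  have hOK : ∀ j : Fin L.length, StateOK σ K O (L.getD j 0) := fun j => (hL j j.2).1
  induction C generalizing j p with
  | name A => exact Iff.rfl
  | nom a =>
    simp only [Concept.encode] at hC ⊢
    have key : p ∈ stateExt K L hN R hpos hR (.nom a) j ↔
        (stateInterpretation K L hN R hpos hR).individual j a = some p := Iff.rfl
    rw [key]
    simp only [stateInterpretation]
    split_ifs with h1 h2
    · have h3 := h1.choose_spec.1
      have h4 := h1.choose_spec.2.2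
      constructor
      · intro h
        cases h
        exact ⟨h3, h4⟩
      · rintro ⟨h5, h6⟩
        exact congrArg some ((hOK j).nom a (by omega) hC _ h3 _ h5 h4 h6)
    · obtain ⟨q, hq, hqa⟩ := (hOK j).nom_total h2 a (by omega) hC
      exact absurd ⟨q, hq, hC, hqa⟩ h1
    · simp only [false_iff]
      exact fun h => h1 ⟨p, h.1, hC, h.2⟩
  | desc C ih =>
    simp only [Concept.encode] at hC ⊢
    have hC' : C.encode < K := by omega
    have key : p ∈ stateExt K L hN R hpos hR (.desc C) j ↔
        p ∈ stateExt K L hN R hpos hR C j ∧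
        ∀ q ∈ stateExt K L hN R hpos hR C j, q = p :=
      Set.eq_singleton_iff_unique_mem
    rw [key,
      show _ ↔ _ from ih hC' j p]
    constructor
    · rintro ⟨⟨hp, h1⟩, h2⟩
      exact ⟨hp, ((hOK j).desc _ hC' hC p hp).2
        ⟨h1, fun q hq hqb => h2 q ((ih hC' j q).2 ⟨hq, hqb⟩)⟩⟩
    · rintro ⟨hp, h1⟩
      obtain ⟨h2, h3⟩ := ((hOK j).desc _ hC' hC p hp).1 h1
      exact ⟨⟨hp, h2⟩, fun q hq => h3 q ((ih hC' j q).1 hq).1 ((ih hC' j q).1 hq).2⟩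
  | neg C ih =>
    simp only [Concept.encode] at hC ⊢
    have hC' : C.encode < K := by omega
    have key : p ∈ stateExt K L hN R hpos hR (.neg C) j ↔
        p < (L.getD j 0).1 ∧ ¬ p ∈ stateExt K L hN R hpos hR C j := Iff.rfl
    rw [key,
      show _ ↔ _ from ih hC' j p]
    refine and_congr_right fun hp => ?_
    rw [(hOK j).neg _ hC' hC p hp]
    tauto
  | and C D ihC ihD =>
    change andCode C.encode D.encode < K at hC
    have hC' := left_lt_of_andCode_lt hC
    have hD' := right_lt_of_andCode_lt hC
    have key : p ∈ stateExt K L hN R hpos hR (.and C D) j ↔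
        p ∈ stateExt K L hN R hpos hR C j ∧
        p ∈ stateExt K L hN R hpos hR D j := Iff.rfl
    rw [key,
      show _ ↔ _ from ihC hC' j p, show _ ↔ _ from ihD hD' j p, ← and_and_left]
    exact and_congr_right fun hp => ((hOK j).and _ hC' _ hD' hC p hp).symm
  | ex r C ih =>
    change exCode r C.encode < K at hC
    have hC' := right_lt_of_exCode_lt hC
    have key : p ∈ stateExt K L hN R hpos hR (.ex r C) j ↔
        p < (L.getD j 0).1 ∧ ∃ q, (p < (L.getD j 0).1 ∧ q < (L.getD j 0).1 ∧
          ∀ d < K, exCode r d < K → Bit (row K (L.getD j 0) q) d →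
            Bit (row K (L.getD j 0) p) (exCode r d)) ∧
          q ∈ stateExt K L hN R hpos hR C j := Iff.rfl
    rw [key]
    refine and_congr_right fun hp => ⟨?_, fun h => ?_⟩
    · rintro ⟨q, ⟨-, -, h⟩, hq⟩
      exact h _ hC' hC ((ih hC' j q).1 hq).2
    · obtain ⟨q, hq, h1, h2⟩ := (hOK j).ex r (left_lt_of_exCode_lt hC) _ hC' hC p hp h
      exact ⟨q, ⟨hp, hq, h2⟩, (ih hC' j q).2 ⟨hq, h1⟩⟩
  | exU C ih =>
    simp only [Concept.encode] at hC ⊢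
    have hC' : C.encode < K := by omega
    have key : p ∈ stateExt K L hN R hpos hR (.exU C) j ↔
        p < (L.getD j 0).1 ∧ ∃ q, q < (L.getD j 0).1 ∧
          q ∈ stateExt K L hN R hpos hR C j := Iff.rfl
    rw [key]
    refine and_congr_right fun hp => ?_
    rw [(hOK j).exU _ hC' hC p hp]
    refine exists_congr fun q => and_congr_right fun hq => ?_
    rw [show _ ↔ _ from ih hC' j q]
    exact and_iff_right hq
  | dia i C ih =>
    change diaCode σ.mods i C.encode < K at hC
    have hC' := lt_of_diaCode_lt i.pos hC
    have key : p ∈ stateExt K L hN R hpos hR (.dia i C) j ↔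
        p < (L.getD j 0).1 ∧ ∃ k, R i j k ∧
          p ∈ stateExt K L hN R hpos hR C k := Iff.rfl
    rw [key]
    refine and_congr_right fun hp => ?_
    change _ ↔ Bit _ (diaCode σ.mods i C.encode)
    clear key
    -- A path diamond refers to itself at the successor, so the equivalence is proved from the end
    -- of the list backwards; `StepEq` supplies the unfolding at each state.
    induction j using WellFoundedGT.induction with
    | _ j ihj =>
    have hE' := hE i j fun k => p ∈ stateExt K L hN R hpos hR C k
    refine Iff.trans hE' ⟨?_, fun hb => ?_⟩
    · rintro (⟨hr, hX⟩ | ⟨h, hh, k, ⟨hjk, hcomp⟩, hrel, hit⟩)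
      · exact (hOK j).refl hr i i.2 _ hC' hC p hp ((ih hC' j p).1 hX).2
      · refine hcomp.2 p hp i i.2 _ hC' hC hrel ?_
        have hpk : p < (L.getD k 0).1 := lt_of_lt_of_le hp hcomp.1
        rcases hit with hX | ⟨hb, hX⟩
        · exact Or.inl ((ih hC' k p).1 hX).2
        · exact Or.inr ⟨hb, (ihj k hjk hpk).1 hX⟩
    · by_cases hrefl : σ.refl ∧ Bit (row K (L.getD j 0) p) C.encode
      · exact Or.inl ⟨hrefl.1, (ih hC' j p).2 ⟨hp, hrefl.2⟩⟩
      · obtain ⟨k, hk, hjk, h, hh, hrel, hcomp, hit⟩ :=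
          (hL j j.2).2 p hp i i.2 _ hC' ⟨hC, hb, hrefl⟩
        have hpk : p < (L.getD k 0).1 := lt_of_lt_of_le hp hcomp.1
        refine Or.inr ⟨h, hh, ⟨k, hk⟩, ⟨hjk, hcomp⟩, hrel, ?_⟩
        rcases hit with hX | ⟨hb, hX⟩
        · exact Or.inl ((ih hC' ⟨k, hk⟩ p).2 ⟨hpk, hX⟩)
        · exact Or.inr ⟨hb, (ihj ⟨k, hk⟩ hjk hpk).2 hX⟩

theorem SatCert.satisfiable {𝒞 : Set (Frame σ.mods)} (h𝒞 : Describes σ 𝒞) {C : Concept σ.mods}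
    {O : Ontology σ.mods} {K : ℕ} {L : List (ℕ × ℕ)} (h : SatCert σ C.encode O.codes K L) :
    SpecSatisfiable σ 𝒞 C O := by
  obtain ⟨⟨hCK, hOK⟩, hL, s, hs, p, hp, hpC⟩ := h
  obtain ⟨j, hj, rfl⟩ := List.getElem_of_mem hs
  have hN : Nonempty (Fin L.length) := ⟨⟨j, hj⟩⟩
  have hpos : ∀ j : Fin L.length, 0 < (L.getD j 0).1 := fun j => by
    obtain ⟨q, hq⟩ := (hL j j.2).1.nonempty
    exact (Nat.zero_le q).trans_lt hq
  -- All compatible pairs in list order become successors. Coherence supplies the witnesses,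
  -- compatibility rules out unwanted diamonds, and the list order ensures acyclicity.
  obtain ⟨R, hmem, hR, hE⟩ := h𝒞.build L.length hN
    (fun h j k => j < k ∧ Compat σ K h (L.getD j 0) (L.getD k 0)) fun _ _ _ h => h.1
  have hR' : ∀ i j k, R i j k → (L.getD j 0).1 ≤ (L.getD k 0).1 := by
    intro i j k h
    have h' := hR i j k h
    clear h
    induction h' with
    | refl => exact le_rfl
    | tail _ h ih =>
      obtain ⟨_, _, _, h'⟩ := h
      exact ih.trans h'.1
  have key := mem_ext_stateInterpretation hL (hN := hN) (hpos := hpos) (hR := hR') hE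
  refine ⟨_, hmem, stateInterpretation K L hN R hpos hR', stateInterpretation_isTotal,
    fun q hq j x hx => ?_, ⟨j, hj⟩, p, ?_⟩
  · have hq' : (q.1.encode, q.2.encode) ∈ O.codes := List.mem_map_of_mem hq
    obtain ⟨h1, h2⟩ := (key q.1 (hOK _ hq').1 j x).1 hx
    exact (key q.2 (hOK _ hq').2 j x).2 ⟨h1, (hL j j.2).1.onto _ hq' x h1 h2⟩
  · refine (key C hCK ⟨j, hj⟩ p).2 ?_
    simpa [hj] using And.intro hp hpC

end Soundness

/-! ### Types in models and soundness of negative certificates -/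

section ModelTypes

variable {m : ℕ} [NeZero m] {F : Frame m} (M : PartialInterpretation F)

open Classical in
/-- The type of an element `d` at a world `w`: the set of all concepts with Gödel number less than
`K` to whose extension it belongs. -/
noncomputable def PartialInterpretation.typeAt (K : ℕ) (w : F.World) (d : M.Carrier) : ℕ :=
  Nat.ofBits fun c : Fin K => decide (d ∈ M.ext (Concept.ofNat c) w)

theorem PartialInterpretation.typeAt_lt (K : ℕ) (w : F.World) (d : M.Carrier) :
    M.typeAt K w d < 2 ^ K := Nat.ofBits_lt_two_pow _

theorem PartialInterpretation.bit_typeAt {K : ℕ} {w : F.World} {d : M.Carrier} {c : ℕ}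
    (hc : c < K) : Bit (M.typeAt K w d) c ↔ d ∈ M.ext (Concept.ofNat c) w := by
  rw [bit_iff_testBit, typeAt, Nat.testBit_ofBits_lt _ _ hc]
  simp

theorem PartialInterpretation.bit_typeAt_encode {K : ℕ} {w : F.World} {d : M.Carrier}
    {C : Concept m} (hC : C.encode < K) : Bit (M.typeAt K w d) C.encode ↔ d ∈ M.ext C w := by
  rw [M.bit_typeAt hC, Concept.ofNat_encode]

end ModelTypes

section Completeness

variable {σ : Spec} [NeZero σ.mods]

theorem PartialInterpretation.localOK {F : Frame σ.mods} (M : PartialInterpretation F)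
    {O : Ontology σ.mods} {K : ℕ} (htot : σ.total → M.IsTotal) (hO : M.Models O)
    (hK : ∀ q ∈ O.codes, q.1 < K ∧ q.2 < K) {E : ℕ → F.World → F.World → Prop}
    (hE : StepEq σ F.R E) (w : F.World) : LocalOK σ K O.codes (M.dom w) (M.typeAt K w) := by
  have hb : ∀ (C : Concept σ.mods) d, C.encode < K →
      (Bit (M.typeAt K w d) C.encode ↔ d ∈ M.ext C w) := fun C d h => M.bit_typeAt_encode h
  have hn : ∀ e d, e < K → (Bit (M.typeAt K w d) e ↔ d ∈ M.ext (.ofNat e) w) :=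
    fun e d h => M.bit_typeAt h
  have enc : ∀ e, (Concept.ofNat e : Concept σ.mods).encode = e := Concept.encode_ofNat
  refine ⟨M.dom_nonempty w, ?_, ?_, ?_, ?_, ?_, ?_, ?_, ?_, ?_⟩
  · intro q hq d _ h
    obtain ⟨h1, h2⟩ := hK q hq
    obtain ⟨p, hp, rfl⟩ := List.mem_map.1 hq
    exact (hb _ d h2).2 (hO p hp w ((hb _ d h1).1 h))
  · intro a _ ha d _ e _ h1 h2
    have h1' : M.individual w a = some d := (hb (.nom a) d ha).1 h1
    have h2' : M.individual w a = some e := (hb (.nom a) e ha).1 h2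
    exact Option.some.inj (h1'.symm.trans h2')
  · intro ht a _ ha
    obtain ⟨d, hd⟩ := Option.isSome_iff_exists.1 (htot ht w a)
    exact ⟨d, M.individual_mem w a d hd, (hb (.nom a) d ha).2 hd⟩
  · intro e he he' d hd
    have h := hb (.desc (.ofNat e)) d (by simpa only [Concept.encode, enc] using he')
    simp only [Concept.encode, enc] at h
    rw [h, hn e d he]
    refine Iff.trans Set.eq_singleton_iff_unique_mem (and_congr_right fun _ => ?_)
    refine forall_congr' fun q => ⟨fun h _ hq => h ((hn e q he).1 hq), fun h hq => ?_⟩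
    exact h (M.ext_subset_dom _ _ hq) ((hn e q he).2 hq)
  · intro e he he' d hd
    have h := hb (.neg (.ofNat e)) d (by simpa only [Concept.encode, enc] using he')
    simp only [Concept.encode, enc] at h
    rw [h, hn e d he]
    exact and_iff_right hd
  · intro c hc e he he' d hd
    have h := hb (.and (.ofNat c) (.ofNat e)) d
      (by simpa only [Concept.encode, enc, andCode] using he')
    simp only [Concept.encode, enc] at h
    rw [hn c d hc, hn e d he]
    exact h
  · intro r hr e he he' d hd
    have h : ∀ e, exCode r e < K → ∀ d, Bit (M.typeAt K w d) (exCode r e) ↔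
        d ∈ M.dom w ∧ ∃ q, M.roleName w r d q ∧ q ∈ M.ext (.ofNat e) w := by
      intro e he' d
      have h := hb (.ex r (.ofNat e)) d (by simpa only [Concept.encode, enc, exCode] using he')
      simp only [Concept.encode, enc] at h
      exact h
    rw [h e he' d]
    rintro ⟨-, q, hq, hqe⟩
    exact ⟨q, (M.roleName_dom _ _ _ _ hq).2, (hn e q he).2 hqe, fun c hc hc' hqc =>
      (h c hc' d).2 ⟨hd, q, hq, (hn c q hc).1 hqc⟩⟩
  · intro e he he' d hd
    have h := hb (.exU (.ofNat e)) d (by simpa only [Concept.encode, enc] using he')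
    simp only [Concept.encode, enc] at h
    rw [h]
    refine Iff.trans (and_iff_right hd) ?_
    exact exists_congr fun q => and_congr_right fun _ => (hn e q he).symm
  · intro hr i hi e he he' d hd hde
    have h := hb (.dia ⟨i, hi⟩ (.ofNat e)) d
      (by simpa only [Concept.encode, enc, diaCode] using he')
    simp only [Concept.encode, enc] at h
    refine h.2 ⟨hd, (hE ⟨i, hi⟩ w fun v => d ∈ M.ext (.ofNat e) v).2 (Or.inl ⟨hr, ?_⟩)⟩
    exact (hn e d he).1 hde

/-- Well-founded induction along successors shows that no state embedded in a world is excluded.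
Only the generator `b` below the state is tracked: its elements persist at the successor, where they
extend to a state of bounded length. -/
theorem UnsatCert.not_satisfiable {𝒞 : Set (Frame σ.mods)} (h𝒞 : Describes σ 𝒞)
    {C : Concept σ.mods} {O : Ontology σ.mods} {K : ℕ} {B : List (ℕ × ℕ)}
    (h : UnsatCert σ C.encode O.codes K B) : ¬ SpecSatisfiable σ 𝒞 C O := by
  rintro ⟨F, hF, M, htot, hO, w, d, hd⟩
  obtain ⟨⟨hCK, hOK⟩, hB, hroot⟩ := h
  obtain ⟨E, hwf, hER, hE⟩ := h𝒞.unfold F hF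
  have hloc := M.localOK htot hO hOK hE
  -- The unfolding equation in terms of types: a diamond bit is determined by the element's own type
  -- and its types at immediate successors.
  have hdia : ∀ (w : F.World) (d : M.Carrier) (i : Fin σ.mods) (e : ℕ),
      diaCode σ.mods i e < K → d ∈ M.dom w →
      (Bit (M.typeAt K w d) (diaCode σ.mods i e) ↔ (σ.refl ∧ Bit (M.typeAt K w d) e) ∨
        ∃ h < σ.steps, ∃ v, E h w v ∧ Relevant σ h i ∧ Hit σ (M.typeAt K v d) i e) := by
    intro w d i e he hd
    have he' : e < K := lt_of_diaCode_lt i.pos he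
    have h1 : ∀ v, d ∈ M.dom v → (Bit (M.typeAt K v d) (diaCode σ.mods i e) ↔
        ∃ u, F.R i v u ∧ d ∈ M.ext (.ofNat e) u) := by
      intro v hd
      have h := M.bit_typeAt_encode (K := K) (w := v) (d := d) (C := .dia i (.ofNat e))
        (by simpa only [Concept.encode, Concept.encode_ofNat, diaCode] using he)
      simp only [Concept.encode, Concept.encode_ofNat] at h
      exact h.trans (and_iff_right hd)
    rw [h1 w hd, M.bit_typeAt he']
    refine (hE i w fun v => d ∈ M.ext (.ofNat e) v).trans (or_congr Iff.rfl ?_)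
    refine exists_congr fun h => and_congr_right fun hh => exists_congr fun v =>
      and_congr_right fun hv => and_congr_right fun _ => ?_
    obtain ⟨j, hj⟩ := hER h hh w v hv
    unfold Hit
    rw [M.bit_typeAt he', h1 v (M.expanding j w v hj hd)]
  have key : ∀ w (s : ℕ × ℕ) (f : ℕ → M.Carrier),
      Embeds {p | p < s.1} (row K s) (M.dom w) (M.typeAt K w) f → ¬ Excluded K B s := by
    intro w
    induction w using hwf.induction with
    | _ w ih =>
    rintro s f hf ⟨b, hb, hbs⟩
    obtain ⟨g, hg⟩ := hbs.exists_embeds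
    have hfg := hf.comp hg
    generalize f ∘ g = f' at hfg
    obtain ⟨p, hp, i, hi, e, he, ⟨hc, hbit, hnrefl⟩, hwit⟩ := hB b hb ((hloc w).of_embeds hfg)
    rw [← hfg.ty_eq p hp] at hbit hnrefl
    obtain ⟨h, hh, v, hv, hrel, hit⟩ :=
      ((hdia w (f' p) ⟨i, hi⟩ e hc (hfg.mapsTo hp)).1 hbit).resolve_left hnrefl
    obtain ⟨j, hj⟩ := hER h hh w v hv
    have hseq : IsSeq (M.dom v) b.1 f' :=
      ⟨fun q hq => M.expanding j w v hj (hfg.mapsTo hq), hfg.injOn⟩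
    obtain ⟨l, x, g', hbl, hl, hx, hg', hemb⟩ :=
      exists_state_embeds (fun q _ => M.typeAt_lt K v q) hseq
    have hrow : ∀ q < b.1, row K (l, x) q = M.typeAt K v (f' q) := fun q hq => by
      rw [← hg' q hq]
      exact (hemb.ty_eq q (lt_of_lt_of_le hq hbl)).symm
    refine ih v ⟨h, hh, hv⟩ (l, x) g' hemb
      (hwit l (Nat.lt_succ_of_le hl) x hx ((hloc v).of_embeds hemb)
        ⟨h, hh, hrel, ⟨hbl, fun q hq i' hi' e' he' hc' hrel' hit' => ?_⟩, ?_⟩)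
    · rw [← hfg.ty_eq q hq]
      refine (hdia w (f' q) ⟨i', hi'⟩ e' hc' (hfg.mapsTo hq)).2
        (Or.inr ⟨h, hh, v, hv, hrel', ?_⟩)
      rwa [← hrow q hq]
    · rwa [hrow p hp]
  -- Extending the empty sequence gives a root state with at most two elements per type, hence
  -- within the range checked by the certificate.
  obtain ⟨l, x, g, -, hl, hx, -, hemb⟩ := exists_state_embeds (D := M.dom w) (ty := M.typeAt K w)
    (K := K) (l := 0) (f := fun _ => d) (fun q _ => M.typeAt_lt K w q)
    ⟨fun _ h => absurd h (Nat.not_lt_zero _), fun _ h => absurd h (Nat.not_lt_zero _)⟩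
  refine key w (l, x) g hemb (hroot l (by omega) x hx ((hloc w).of_embeds hemb) ?_)
  exact (hemb.exists_bit_iff _).2 ⟨d, M.ext_subset_dom C w hd, (M.bit_typeAt_encode hCK).2 hd⟩

end Completeness

/-! ### Existence of a positive or a negative certificate -/

section Certificates

variable {σ : Spec} {K : ℕ} {O : List (ℕ × ℕ)}

/-- Witnesses are sought within the same list, so coherent lists for different diamonds can be put
together. -/
theorem Coherent.append {L L' : List (ℕ × ℕ)} (hL : Coherent σ K O L) (hL' : Coherent σ K O L') :
    Coherent σ K O (L ++ L') := by
  intro j hj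
  rw [List.length_append] at hj
  rcases lt_or_ge j L.length with hlt | hge
  · rw [List.getD_append _ _ _ _ hlt]
    refine ⟨(hL j hlt).1, fun p hp i hi e he hreq => ?_⟩
    obtain ⟨k, hk, hjk, hw⟩ := (hL j hlt).2 p hp i hi e he hreq
    exact ⟨k, by rw [List.length_append]; omega, hjk, by rwa [List.getD_append _ _ _ _ hk]⟩
  · rw [List.getD_append_right _ _ _ _ hge]
    have h' := hL' (j - L.length) (by omega)
    refine ⟨h'.1, fun p hp i hi e he hreq => ?_⟩
    obtain ⟨k, hk, hjk, hw⟩ := h'.2 p hp i hi e he hreq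
    refine ⟨L.length + k, by rw [List.length_append]; omega, by omega, ?_⟩
    rwa [List.getD_append_right _ _ _ _ (by omega), Nat.add_sub_cancel_left]

theorem Coherent.cons {L : List (ℕ × ℕ)} (hL : Coherent σ K O L) {s : ℕ × ℕ}
    (hs : StateOK σ K O s) (hw : ∀ p < s.1, ∀ i < σ.mods, ∀ e < K, Requires σ K s p i e →
      ∃ s' ∈ L, IsWitness σ K s s' p i e) : Coherent σ K O (s :: L) := by
  intro j hj
  rcases j with _ | j
  · refine ⟨hs, fun p hp i hi e he hreq => ?_⟩
    obtain ⟨s', hs', hw'⟩ := hw p hp i hi e he hreq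
    obtain ⟨k, hk, rfl⟩ := List.getElem_of_mem hs'
    refine ⟨k + 1, by simpa using hk, Nat.succ_pos k, ?_⟩
    simpa [hk] using hw'
  · rw [List.length_cons, Nat.add_lt_add_iff_right] at hj
    rw [List.getD_cons_succ]
    refine ⟨(hL j hj).1, fun p hp i hi e he hreq => ?_⟩
    obtain ⟨k, hk, hjk, hw'⟩ := (hL j hj).2 p hp i hi e he hreq
    exact ⟨k + 1, by simpa using hk, by omega, by rwa [List.getD_cons_succ]⟩

/-- The state `s` occurs in a coherent list of states. -/
def Realizable (σ : Spec) (K : ℕ) (O : List (ℕ × ℕ)) (s : ℕ × ℕ) : Prop :=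
  ∃ L, Coherent σ K O L ∧ s ∈ L

theorem exists_coherent_of_forall_realizable {ι : Type*} (P : ι → ℕ × ℕ → Prop) (I : List ι)
    (h : ∀ t ∈ I, ∃ s, Realizable σ K O s ∧ P t s) :
    ∃ L, Coherent σ K O L ∧ ∀ t ∈ I, ∃ s ∈ L, P t s := by
  induction I with
  | nil => exact ⟨[], fun j hj => absurd hj (Nat.not_lt_zero j), by simp⟩
  | cons t I ih =>
    obtain ⟨L, hL, hLI⟩ := ih fun u hu => h u (List.mem_cons_of_mem t hu)
    obtain ⟨s, ⟨L', hL', hs⟩, hts⟩ := h t List.mem_cons_self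
    refine ⟨L' ++ L, hL'.append hL, fun u hu => ?_⟩
    rcases List.mem_cons.1 hu with rfl | hu
    · exact ⟨s, List.mem_append_left L hs, hts⟩
    · obtain ⟨s', hs', hus⟩ := hLI u hu
      exact ⟨s', List.mem_append_right L' hs', hus⟩

/-- A state has finitely many requirements, so the lists of their witnesses can be concatenated and
the state placed in front. -/
theorem Realizable.of_witnesses {s : ℕ × ℕ} (hs : StateOK σ K O s)
    (h : ∀ p < s.1, ∀ i < σ.mods, ∀ e < K, Requires σ K s p i e →
      ∃ s', Realizable σ K O s' ∧ IsWitness σ K s s' p i e) : Realizable σ K O s := by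
  classical
  let I : List (ℕ × ℕ × ℕ) :=
    (Finset.range s.1 ×ˢ Finset.range σ.mods ×ˢ Finset.range K).toList.filter
      fun t => Requires σ K s t.1 t.2.1 t.2.2
  have hI : ∀ t, t ∈ I ↔ (t.1 < s.1 ∧ t.2.1 < σ.mods ∧ t.2.2 < K) ∧
      Requires σ K s t.1 t.2.1 t.2.2 := by
    intro t
    simp [I]
  obtain ⟨L, hL, hLI⟩ := exists_coherent_of_forall_realizable
    (fun t s' => IsWitness σ K s s' t.1 t.2.1 t.2.2) I fun t ht => by
      obtain ⟨⟨h1, h2, h3⟩, h4⟩ := (hI t).1 ht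
      exact h t.1 h1 t.2.1 h2 t.2.2 h3 h4
  exact ⟨s :: L, hL.cons hs fun p hp i hi e he hreq =>
    hLI (p, i, e) ((hI _).2 ⟨⟨hp, hi, he⟩, hreq⟩), List.mem_cons_self⟩

/-- The list consists of unrealizable states generating all others. If every requirement of a
consistent generator had a non-excluded, hence realizable, witness, the generator would be
realizable too. -/
theorem exists_unsatCert {C : ℕ} (hK : Bounds K C O) (h : ∀ L, ¬ SatCert σ C O K L) :
    ∃ B, UnsatCert σ C O K B := by
  obtain ⟨B, hB, hU⟩ := exists_finite_basis K {s | ¬ Realizable σ K O s}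
  refine ⟨B, hK, fun b hb hok => ?_, fun l _ x _ _ hC => hU _ ?_⟩
  · by_contra! hcon
    refine hB b hb (Realizable.of_witnesses hok fun p hp i hi e he hreq => ?_)
    obtain ⟨l, -, x, -, -, hw, hex⟩ := hcon p hp i hi e he hreq
    exact ⟨(l, x), by_contra fun hr => hex (hU _ hr), hw⟩
  · rintro ⟨L, hL, hs⟩
    exact h L ⟨hK, hL, _, hs, hC⟩

theorem exists_bounds (C : ℕ) (O : List (ℕ × ℕ)) : ∃ K, Bounds K C O := by
  induction O with
  | nil => exact ⟨C + 1, C.lt_succ_self, by simp⟩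
  | cons q O ih =>
    obtain ⟨K, hC, hO⟩ := ih
    refine ⟨K + q.1 + q.2 + 1, by omega, fun r hr => ?_⟩
    rcases List.mem_cons.1 hr with rfl | hr
    · omega
    · have := hO r hr
      omega

end Certificates

/-- A positive certificate is not extracted from a model directly: if none existed there would be a
negative one, which contradicts satisfiability. -/
theorem computablePred_specSatisfiable {σ : Spec} [NeZero σ.mods] {𝒞 : Set (Frame σ.mods)}
    (h𝒞 : Describes σ 𝒞) :
    ComputablePred fun p : Concept σ.mods × Ontology σ.mods => SpecSatisfiable σ 𝒞 p.1 p.2 := by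
  have henc : Primrec (Concept.encode : Concept σ.mods → ℕ) := Primrec.encode
  have hcodes : Primrec (Ontology.codes : Ontology σ.mods → List (ℕ × ℕ)) :=
    Primrec.list_map Primrec.id
      (((henc.comp Primrec.fst).pair (henc.comp Primrec.snd)).comp Primrec.snd)
  have hex : ∀ (C : ℕ) O, ¬ (∃ K L, SatCert σ C O K L) → ∃ K B, UnsatCert σ C O K B := by
    intro C O h
    obtain ⟨K, hK⟩ := exists_bounds C O
    exact ⟨K, exists_unsatCert hK fun L hL => h ⟨K, L, hL⟩⟩
  refine computablePred_of_cert (σ := σ) (henc.comp Primrec.fst) (hcodes.comp Primrec.snd)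
    (fun p => ⟨fun h => ?_, ?_⟩) fun p => ⟨fun h => hex _ _ ?_, ?_⟩
  · by_contra hno
    obtain ⟨K, B, hB⟩ := hex _ _ hno
    exact hB.not_satisfiable h𝒞 h
  · rintro ⟨K, L, hL⟩
    exact hL.satisfiable h𝒞
  · rintro ⟨K, L, hL⟩
    exact h (hL.satisfiable h𝒞)
  · rintro ⟨K, B, hB⟩
    exact hB.not_satisfiable h𝒞

/-! ### The three frame classes -/

/-- The shape of the frames in `KfStarFrames n`. -/
abbrev kfStarSpec (n : ℕ) (total : Prop) : Spec := ⟨n + 1, n, n, False, total⟩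

/-- The shape of the frames in `GLFrames`. -/
abbrev glSpec (total : Prop) : Spec := ⟨1, 0, 1, False, total⟩

/-- The shape of the frames in `GrzFrames`. -/
abbrev grzSpec (total : Prop) : Spec := ⟨1, 0, 1, True, total⟩

/-- A nonempty path is a first step followed by nothing or by another nonempty path; for an operator
below `base`, only its own successor relation is relevant. -/
theorem stepEq_kfStar {n : ℕ} {total : Prop} {W : Type} {R : Fin (n + 1) → W → W → Prop}
    {E : ℕ → W → W → Prop} (hE : ∀ (i : Fin n) w v, R i.castSucc w v ↔ E i w v)
    (hR : ∀ w v, R (Fin.last n) w v ↔ Relation.TransGen (fun x y => ∃ h < n, E h x y) w v) :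
    StepEq (kfStarSpec n total) R E := by
  intro i w X
  simp only [false_and, false_or, Relevant]
  induction i using Fin.lastCases with
  | cast i =>
    constructor
    · rintro ⟨v, hv, hX⟩
      exact ⟨i, i.2, v, (hE i w v).1 hv, Or.inl rfl, Or.inl hX⟩
    · rintro ⟨h, hh, v, hv, hrel, hX⟩
      have hi : ¬ n ≤ (i.castSucc : ℕ) := by simp
      obtain rfl : (i : ℕ) = h := hrel.resolve_right hi
      exact ⟨v, (hE i w v).2 hv, hX.resolve_right fun h => hi h.1⟩
  | last =>
    constructor
    · rintro ⟨v, hv, hX⟩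
      rcases Relation.TransGen.head'_iff.1 ((hR w v).1 hv) with ⟨u, ⟨h, hh, hu⟩, huv⟩
      refine ⟨h, hh, u, hu, Or.inr le_rfl, ?_⟩
      rcases Relation.reflTransGen_iff_eq_or_transGen.1 huv with rfl | huv
      · exact Or.inl hX
      · exact Or.inr ⟨le_rfl, v, (hR u v).2 huv, hX⟩
    · rintro ⟨h, hh, u, hu, -, hX | ⟨-, v, huv, hX⟩⟩
      · exact ⟨u, (hR w u).2 (.single ⟨h, hh, hu⟩), hX⟩
      · exact ⟨v, (hR w v).2 (.head ⟨h, hh, hu⟩ ((hR u v).1 huv)), hX⟩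

theorem transGen_fin_lt {N : ℕ} {P : Fin N → Fin N → Prop} (hP : ∀ j k, P j k → j < k) {j k : Fin N}
    (h : Relation.TransGen P j k) : j < k := by
  induction h with
  | single h => exact hP _ _ h
  | tail _ h ih => exact ih.trans (hP _ _ h)

theorem not_exists_chain_fin {N : ℕ} {P : Fin N → Fin N → Prop} (hP : ∀ j k, P j k → j < k) :
    ¬ ∃ f : ℕ → Fin N, ∀ k, P (f k) (f (k + 1)) := fun ⟨f, hf⟩ =>
  not_injective_infinite_finite f (strictMono_nat_of_lt_succ fun k => hP _ _ (hf k)).injective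

theorem wellFounded_swap_of_no_chain {W : Type} {P : W → W → Prop}
    (h : ¬ ∃ f : ℕ → W, ∀ k, P (f k) (f (k + 1))) : WellFounded fun v w => P w v := by
  rw [wellFounded_iff_isEmpty_descending_chain]
  exact ⟨fun f => h ⟨f.1, f.2⟩⟩

/-- A transitive irreflexive relation on a finite set is conversely well-founded, and so are the
relations it contains. Conversely, increasing edges on `Fin N` have an irreflexive transitive
closure. -/
theorem describes_kfStar (n : ℕ) (total : Prop) :
    Describes (kfStarSpec n total) (KfStarFrames n) where
  unfold := by
    rintro F ⟨hfin, hR, hirr⟩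
    let E : ℕ → F.World → F.World → Prop := fun h w v => ∃ hh : h < n, F.R (Fin.castSucc ⟨h, hh⟩) w v
    have hbase : ∀ x y, (∃ i : Fin n, F.R i.castSucc x y) ↔ ∃ h < n, E h x y := fun x y =>
      ⟨fun ⟨i, hi⟩ => ⟨i, i.2, i.2, hi⟩, fun ⟨h, hh, _, hi⟩ => ⟨⟨h, hh⟩, hi⟩⟩
    have hR' : ∀ w v, F.R (Fin.last n) w v ↔
        Relation.TransGen (fun x y => ∃ h < n, E h x y) w v := by
      intro w v
      rw [hR w v]
      simp only [hbase]
    refine ⟨E, ?_, fun h _ w v ⟨hh, hv⟩ => ⟨_, hv⟩,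
      stepEq_kfStar (fun i w v => ⟨fun h => ⟨i.2, h⟩, fun h => h.2⟩) hR'⟩
    have hwf : WellFounded fun v w => F.R (Fin.last n) w v := by
      have : IsTrans F.World fun v w => F.R (Fin.last n) w v :=
        ⟨fun a b c hab hbc => (hR' c a).2 (((hR' c b).1 hbc).trans ((hR' b a).1 hab))⟩
      have : Std.Irrefl fun v w => F.R (Fin.last n) w v := ⟨hirr⟩
      exact Finite.wellFounded_of_trans_of_irrefl _
    exact Subrelation.wf (fun {v w} h => (hR' w v).2 (.single h)) hwf
  build N hN E hlt := by
    let R : Fin (n + 1) → Fin N → Fin N → Prop :=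
      Fin.lastCases (Relation.TransGen fun x y => ∃ h < n, E h x y) fun i => E i
    have hlast : R (Fin.last n) = Relation.TransGen fun x y => ∃ h < n, E h x y :=
      Fin.lastCases_last
    have hcast : ∀ i : Fin n, R i.castSucc = E i := fun i => Fin.lastCases_castSucc ..
    have hlt' : ∀ j k, (∃ h < n, E h j k) → j < k := fun j k ⟨h, _, hE⟩ => hlt h j k hE
    refine ⟨R, ⟨inferInstanceAs (Finite (Fin N)), fun w v => ?_, fun w h => ?_⟩,
      fun i j k h => ?_, ?_⟩
    · change R (Fin.last n) w v ↔ Relation.TransGen (fun x y => ∃ i : Fin n, R i.castSucc x y) w v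
      simp only [hlast, hcast, Fin.exists_iff, exists_prop]
    · change R (Fin.last n) w w at h
      rw [hlast] at h
      exact lt_irrefl _ (transGen_fin_lt hlt' h)
    · induction i using Fin.lastCases with
      | cast i =>
        rw [hcast] at h
        exact .single ⟨i, i.2, h⟩
      | last =>
        rw [hlast] at h
        exact h.to_reflTransGen
    · exact stepEq_kfStar (fun i w v => by rw [hcast]) fun w v => by rw [hlast]

/-- By transitivity `R` can serve as its own successor relation: following a step by another path
reaches nothing new. -/
theorem describes_gl (total : Prop) : Describes (glSpec total) GLFrames where
  unfold := by
    rintro F ⟨htrans, hchain⟩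
    refine ⟨fun _ => F.R 0, ?_, fun _ _ w v h => ⟨0, h⟩, fun i w X => ?_⟩
    · refine Subrelation.wf (fun {v w} h => ?_) (wellFounded_swap_of_no_chain hchain)
      obtain ⟨_, _, h⟩ := h
      exact h
    · obtain rfl := Subsingleton.elim i 0
      constructor
      · rintro ⟨v, hv, hX⟩
        exact Or.inr ⟨0, Nat.one_pos, v, hv, Or.inl rfl, Or.inl hX⟩
      · rintro (⟨⟨⟩, -⟩ | ⟨-, -, v, hv, -, hX | ⟨-, u, hu, hX⟩⟩)
        · exact ⟨v, hv, hX⟩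
        · exact ⟨u, htrans _ _ _ hv hu, hX⟩
  build N hN E hlt := by
    have hlt' : ∀ j k, Relation.TransGen (E 0) j k → j < k := fun j k h =>
      transGen_fin_lt (hlt 0) h
    have hE : ∀ j k, E 0 j k ↔ ∃ h < 1, E h j k := fun j k => by simp
    refine ⟨fun _ => Relation.TransGen (E 0), ⟨fun _ _ _ => .trans, not_exists_chain_fin hlt'⟩,
      fun _ j k h => ?_, fun i w X => ?_⟩
    · exact (Relation.TransGen.mono (fun _ _ h => (hE _ _).1 h) _ _ h).to_reflTransGen
    · obtain rfl := Subsingleton.elim i 0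
      constructor
      · rintro ⟨v, hv, hX⟩
        obtain ⟨u, hu, huv⟩ := Relation.TransGen.head'_iff.1 hv
        refine Or.inr ⟨0, Nat.one_pos, u, hu, Or.inl rfl, ?_⟩
        rcases Relation.reflTransGen_iff_eq_or_transGen.1 huv with rfl | huv
        · exact Or.inl hX
        · exact Or.inr ⟨le_rfl, v, huv, hX⟩
      · rintro (⟨⟨⟩, -⟩ | ⟨h, hh, u, hu, -, hX | ⟨-, v, huv, hX⟩⟩)
        · exact ⟨u, .single ((hE _ _).2 ⟨h, hh, hu⟩), hX⟩
        · exact ⟨v, .head ((hE _ _).2 ⟨h, hh, hu⟩) huv, hX⟩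

/-- The successor relation is `R` without its diagonal, which is conversely well-founded; the
removed loops are accounted for by `refl`. -/
theorem describes_grz (total : Prop) : Describes (grzSpec total) GrzFrames where
  unfold := by
    rintro F ⟨hrefl, htrans, -, hchain⟩
    refine ⟨fun _ w v => F.R 0 w v ∧ w ≠ v, ?_, fun _ _ w v h => ⟨0, h.1⟩, fun i w X => ?_⟩
    · refine Subrelation.wf (fun {v w} h => ?_) (wellFounded_swap_of_no_chain
        (P := fun w v => F.R 0 w v ∧ w ≠ v) hchain)
      obtain ⟨_, _, h⟩ := h
      exact h
    · obtain rfl := Subsingleton.elim i 0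
      constructor
      · rintro ⟨v, hv, hX⟩
        by_cases hwv : w = v
        · subst hwv
          exact Or.inl ⟨trivial, hX⟩
        · exact Or.inr ⟨0, Nat.one_pos, v, ⟨hv, hwv⟩, Or.inl rfl, Or.inl hX⟩
      · rintro (⟨-, hX⟩ | ⟨-, -, v, hv, -, hX | ⟨-, u, hu, hX⟩⟩)
        · exact ⟨w, hrefl w, hX⟩
        · exact ⟨v, hv.1, hX⟩
        · exact ⟨u, htrans _ _ _ hv.1 hu, hX⟩
  build N hN E hlt := by
    have hle : ∀ j k, Relation.ReflTransGen (E 0) j k → j ≤ k := fun j k h => by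
      rcases Relation.reflTransGen_iff_eq_or_transGen.1 h with rfl | h
      · exact le_rfl
      · exact (transGen_fin_lt (hlt 0) h).le
    have hE : ∀ j k, E 0 j k ↔ ∃ h < 1, E h j k := fun j k => by simp
    refine ⟨fun _ => Relation.ReflTransGen (E 0), ⟨fun _ => .refl, fun _ _ _ => .trans,
      fun j k h h' => le_antisymm (hle j k h) (hle k j h'), not_exists_chain_fin
        (P := fun j k => Relation.ReflTransGen (E 0) j k ∧ j ≠ k)
        fun j k h => lt_of_le_of_ne (hle j k h.1) h.2⟩, fun _ j k h => ?_, fun i w X => ?_⟩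
    · exact Relation.ReflTransGen.mono (fun _ _ h => (hE _ _).1 h) _ _ h
    · obtain rfl := Subsingleton.elim i 0
      constructor
      · rintro ⟨v, hv, hX⟩
        rcases Relation.ReflTransGen.cases_head hv with rfl | ⟨u, hu, huv⟩
        · exact Or.inl ⟨trivial, hX⟩
        · exact Or.inr ⟨0, Nat.one_pos, u, hu, Or.inl rfl, Or.inr ⟨le_rfl, v, huv, hX⟩⟩
      · rintro (⟨-, hX⟩ | ⟨h, hh, u, hu, -, hX | ⟨-, v, huv, hX⟩⟩)
        · exact ⟨w, .refl, hX⟩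
        · exact ⟨u, .single ((hE _ _).2 ⟨h, hh, hu⟩), hX⟩
        · exact ⟨v, .head ((hE _ _).2 ⟨h, hh, hu⟩) huv, hX⟩

theorem decidableSatisfiability_of_describes {m base steps : ℕ} [NeZero m] {refl : Prop}
    {𝒞 : Set (Frame m)} (h : ∀ total, Describes ⟨m, base, steps, refl, total⟩ 𝒞) :
    DecidableSatisfiability 𝒞 := by
  constructor
  · have h' := computablePred_specSatisfiable (h False)
    simpa only [SpecSatisfiable, Satisfiable, false_imp_iff, true_and] using h'
  · have h' := computablePred_specSatisfiable (h True)
    simpa only [SpecSatisfiable, TotallySatisfiable, true_imp_iff] using h'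

end ModalDL

theorem mainTheorem2 :
    (∀ n : ℕ, ModalDL.DecidableSatisfiability (ModalDL.KfStarFrames n)) ∧
    ModalDL.DecidableSatisfiability ModalDL.GLFrames ∧
    ModalDL.DecidableSatisfiability ModalDL.GrzFrames :=
  ⟨fun n => ModalDL.decidableSatisfiability_of_describes (ModalDL.describes_kfStar n),
    ModalDL.decidableSatisfiability_of_describes ModalDL.describes_gl,
    ModalDL.decidableSatisfiability_of_describes ModalDL.describes_grz⟩
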